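/- For a real number $x$ let the irrationality measure $\mu(x)\in(-\infty,+\infty]$ be the infimum of all real $r$ such that, for every $\varepsilon>0$, the inequality $\left|x-\frac ab\right|>\frac1{b^{r+\varepsilon}}$ holds for all sufficiently large integers $b$ and all integers $a$ with $\frac ab\ne x$ (with $\inf\emptyset=+\infty$). Let $p\ge 2$ be an integer, let $q=1/p$, and let $\rho=\dfrac{10\pi^2}{5\pi^2-24}$. Put $$\zeta_q(2)=\sum_{k=1}^\infty\frac{k\,q^k}{1-q^k}.$$ Then $\zeta_q(2)$ is irrational; the inequality $$\left|\zeta_q(2)-\frac ab\right|\le |b|^{-\rho}$$ has at most finitely many solutions $(a,b)$ in integers with $b\neq 0$; and the irrationality measure satisfies $\mu(\zeta_q(2))\le\rho$. -/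

import Mathlib

/-- The `q`-analogue `ζ_q(s) = ∑_{k ≥ 1} k^(s-1) q^k / (1 - q^k)` of the zeta function at a
positive integer `s`. -/
noncomputable def qZeta (q : ℝ) (s : ℕ) : ℝ :=
  ∑' k : ℕ+, ((k : ℕ) : ℝ) ^ (s - 1) * q ^ (k : ℕ) / (1 - q ^ (k : ℕ))

/-- The irrationality measure of a real number `x`: the infimum of the real exponents `r` such that
for every `ε > 0` and all sufficiently large integers `b`, every fraction `a / b ≠ x` satisfies
`|x - a / b| > 1 / b ^ (r + ε)`. The infimum is taken in the extended reals, so that it is `⊤`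
when no exponent is admissible. For irrational `x` the condition `a / b ≠ x` is automatic; for
rational `x` it gives the usual value `1`. -/
noncomputable def irrationalityMeasure (x : ℝ) : EReal :=
  sInf {t : EReal | ∃ r : ℝ, t = (r : EReal) ∧
    ∀ ε : ℝ, 0 < ε → ∀ᶠ b : ℤ in Filter.atTop, ∀ a : ℤ,
      x ≠ (a : ℝ) / (b : ℝ) → 1 / (b : ℝ) ^ (r + ε) < |x - (a : ℝ) / (b : ℝ)|}

/-!
For integers `0 < s ≤ n ≤ N` and `0 < M ≤ n - s + 1` consider the rational function
`R(X) = X ^ M ∏_{1 ≤ j ≤ N} (1 - p ^ j X) / (∏_{i ≤ N} (1 - q ^ i X) ∏_{s ≤ i ≤ n} (1 - q ^ i X))`.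
Its partial fraction expansion is a sum of terms `A_k x / (1 - x) ^ 2` for `s ≤ k ≤ n` and
`C_k / (1 - x)` for `k ≤ N`, where `x = q ^ k X`. As `R(0) = 0`, the `C_k` add up to zero, and the
sum of `R(q ^ t)` over `t ≥ 1` is a linear form in `1` and `ζ_q(2) = ∑ q ^ t / (1 - q ^ t) ^ 2` with
rational coefficients (`hasSum_linearForm`). The terms with `t ≤ N` vanish and the others are
positive, so that the form is positive and comparable to its first term, of size `q ^ (M (N + 1))`
(`value_bounds`).

The coefficients are, up to powers of `p`, products of `q`-binomial coefficients divided by numbers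
`p ^ i - 1`. All of these are products of values `Φ_l(p)` of cyclotomic polynomials, and integrality
is checked one `l` at a time: it becomes an inequality between integer parts
(`le_exponent_of_double`, `le_exponent_of_lt`, `le_exponent_of_gt`).

With `s = 0` and `M = N = n` the common denominator is the square of the least common multiple
of the `p ^ i - 1`, `i ≤ n`, and the exponent obtained from these forms is exactly
`ρ = 10 π² / (5 π² - 24)`. Finiteness of the set of solutions with the exponent `ρ` itself needs
something strictly better. It comes from `M = 19 r`, `N = 21 r`, `s = r`, `n = 20 r`: for
`10 r < l ≤ 11 r` the product of `q`-binomial coefficients is divisible by `Φ_l(p)` whenever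
`p ^ l - 1` occurs in the harmonic-type sums, which saves one factor `Φ_l(p)` in the common
denominator. This gain outweighs the loss in the other parameters (`exponent_lt`).

The size of the denominator follows from `∑_{l ≤ n} log Φ_l(p) ~ 3 n² log p / π²`
(`tendsto_logLcm`). The forms have size `exp (-α r² + o(r²))` from both sides and the coefficients
of `ζ_q(2)` have size at most `exp (β r² + o(r²))`, where `1 + β / α < ρ`. This gives
`|ζ_q(2) - a / b| > b ^ (-η)` for some `η < ρ` and all large `b` (`exists_forall_lt_abs_sub`), hence
all three assertions.
-/

namespace QZetaTwo

open Finset Filter Topology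

section

/-! ### Products of cyclotomic values -/

/-- The value `Φ_l(p)` of the `l`-th cyclotomic polynomial, as a real number. -/
noncomputable def cyc (p l : ℕ) : ℝ := (Polynomial.cyclotomic l ℝ).eval (p : ℝ)

/-- The product `∏_{1 ≤ l ≤ L} Φ_l(p)^(e l)` with integer, possibly negative, exponents. -/
noncomputable def cycProd (p L : ℕ) (e : ℕ → ℤ) : ℝ := ∏ l ∈ Ioc 0 L, cyc p l ^ e l

/-- The product `(p - 1)(p ^ 2 - 1) ⋯ (p ^ a - 1)`. -/
noncomputable def poch (p a : ℕ) : ℝ := ∏ j ∈ Ioc 0 a, ((p : ℝ) ^ j - 1)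

/-- The real numbers that are integers. -/
abbrev intRange : Subring ℝ := (Int.castRingHom ℝ).range

lemma natCast_mem_intRange (n : ℕ) : (n : ℝ) ∈ intRange := ⟨n, by simp⟩

lemma abs_mem_intRange_iff {x : ℝ} : |x| ∈ intRange ↔ x ∈ intRange := by
  rcases abs_choice x with h | h <;> rw [h]
  exact neg_mem_iff

variable {p : ℕ}

lemma one_lt_cast (hp : 2 ≤ p) : (1 : ℝ) < p := by exact_mod_cast hp

lemma cyc_pos (hp : 2 ≤ p) (l : ℕ) : 0 < cyc p l :=
  Polynomial.cyclotomic_pos' l (one_lt_cast hp)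

lemma cyc_mem_intRange (p l : ℕ) : cyc p l ∈ intRange := by
  refine ⟨(Polynomial.cyclotomic l ℤ).eval (p : ℤ), ?_⟩
  rw [cyc, ← Polynomial.map_cyclotomic_int l ℝ, Polynomial.eval_map,
    ← Polynomial.eval₂_at_apply]
  simp

lemma cycProd_pos (hp : 2 ≤ p) (L : ℕ) (e : ℕ → ℤ) : 0 < cycProd p L e :=
  prod_pos fun l _ => zpow_pos (cyc_pos hp l) _

lemma cycProd_mul (hp : 2 ≤ p) (L : ℕ) (e f : ℕ → ℤ) :
    cycProd p L e * cycProd p L f = cycProd p L fun l => e l + f l := by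
  rw [cycProd, cycProd, cycProd, ← prod_mul_distrib]
  exact prod_congr rfl fun l _ => (zpow_add₀ (cyc_pos hp l).ne' _ _).symm

lemma cycProd_div (hp : 2 ≤ p) (L : ℕ) (e f : ℕ → ℤ) :
    cycProd p L e / cycProd p L f = cycProd p L fun l => e l - f l := by
  rw [cycProd, cycProd, cycProd, ← prod_div_distrib]
  exact prod_congr rfl fun l _ => (zpow_sub₀ (cyc_pos hp l).ne' _ _).symm

lemma cycProd_mem_intRange {L : ℕ} {e : ℕ → ℤ} (he : ∀ l, 0 < l → 0 ≤ e l) :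
    cycProd p L e ∈ intRange := by
  refine prod_mem fun l hl => ?_
  obtain ⟨n, hn⟩ := Int.eq_ofNat_of_zero_le (he l (mem_Ioc.1 hl).1)
  rw [hn]
  simpa using pow_mem (cyc_mem_intRange p l) n

lemma prod_divisors_cyc (p : ℕ) {j : ℕ} (hj : 0 < j) :
    ∏ l ∈ j.divisors, cyc p l = (p : ℝ) ^ j - 1 := by
  have h := congrArg (Polynomial.eval (p : ℝ)) (Polynomial.prod_cyclotomic_eq_X_pow_sub_one hj ℝ)
  simpa [Polynomial.eval_prod, cyc] using h

lemma pow_sub_one_eq_cycProd (p : ℕ) {j L : ℕ} (hj : 0 < j) (hL : j ≤ L) :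
    (p : ℝ) ^ j - 1 = cycProd p L fun l => if l ∣ j then 1 else 0 := by
  rw [← prod_divisors_cyc p hj, cycProd]
  have h : j.divisors = (Ioc 0 L).filter (· ∣ j) := by
    ext l
    simp only [Nat.mem_divisors, mem_filter, mem_Ioc]
    refine ⟨fun h => ⟨⟨Nat.pos_of_dvd_of_pos h.1 hj, (Nat.le_of_dvd hj h.1).trans hL⟩, h.1⟩,
      fun h => ⟨h.2, hj.ne'⟩⟩
  rw [h, prod_filter]
  refine prod_congr rfl fun l _ => ?_
  split_ifs <;> simp

lemma poch_succ (p a : ℕ) : poch p (a + 1) = poch p a * ((p : ℝ) ^ (a + 1) - 1) := by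
  rw [poch, poch, ← Finset.insert_Ioc_right_eq_Ioc_add_one (Nat.zero_le a),
    prod_insert (by simp), mul_comm]

lemma poch_eq_cycProd (hp : 2 ≤ p) {a L : ℕ} (ha : a ≤ L) :
    poch p a = cycProd p L fun l => ((a / l : ℕ) : ℤ) := by
  induction a with
  | zero => simp [poch, cycProd]
  | succ a ih =>
    rw [poch_succ, ih (by omega), pow_sub_one_eq_cycProd p (Nat.succ_pos a) ha, cycProd_mul hp]
    congr 1
    ext l
    rw [Nat.succ_div]
    split_ifs <;> simp

lemma poch_pos (hp : 2 ≤ p) (a : ℕ) : 0 < poch p a := by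
  rw [poch_eq_cycProd hp le_rfl]; exact cycProd_pos hp _ _

lemma one_lt_pow_cast (hp : 2 ≤ p) {j : ℕ} (hj : 0 < j) : (1 : ℝ) < (p : ℝ) ^ j :=
  one_lt_pow₀ (one_lt_cast hp) hj.ne'

lemma log_pow_sub_one_le (hp : 2 ≤ p) (j : ℕ) :
    Real.log ((p : ℝ) ^ j - 1) ≤ j * Real.log p := by
  rcases Nat.eq_zero_or_pos j with rfl | hj
  · simp
  rw [← Real.log_pow]
  exact Real.log_le_log (sub_pos.2 (one_lt_pow_cast hp hj)) (by linarith)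

lemma le_log_pow_sub_one (hp : 2 ≤ p) {j : ℕ} (hj : 0 < j) :
    j * Real.log p - Real.log 2 ≤ Real.log ((p : ℝ) ^ j - 1) := by
  have h2 : (2 : ℝ) ≤ (p : ℝ) ^ j := by
    calc (2 : ℝ) ≤ p := by exact_mod_cast hp
      _ ≤ (p : ℝ) ^ j := le_self_pow₀ (one_lt_cast hp).le hj.ne'
  rw [← Real.log_pow, ← Real.log_div (by positivity) (by norm_num)]
  exact Real.log_le_log (by positivity) (by linarith)

lemma sum_Ioc_cast (a : ℕ) : ∑ j ∈ Ioc 0 a, (j : ℝ) = a * (a + 1) / 2 := by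
  induction a with
  | zero => simp
  | succ a ih =>
    rw [← Finset.insert_Ioc_right_eq_Ioc_add_one (Nat.zero_le a), sum_insert (by simp), ih]
    push_cast; ring

lemma log_poch (hp : 2 ≤ p) (a : ℕ) :
    Real.log (poch p a) = ∑ j ∈ Ioc 0 a, Real.log ((p : ℝ) ^ j - 1) :=
  Real.log_prod fun _ hj => (sub_pos.2 (one_lt_pow_cast hp (mem_Ioc.1 hj).1)).ne'

lemma log_poch_le (hp : 2 ≤ p) (a : ℕ) :
    Real.log (poch p a) ≤ a * (a + 1) / 2 * Real.log p := by
  rw [log_poch hp, ← sum_Ioc_cast, sum_mul]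
  exact sum_le_sum fun j _ => log_pow_sub_one_le hp j

lemma le_log_poch (hp : 2 ≤ p) (a : ℕ) :
    a * (a + 1) / 2 * Real.log p - a * Real.log 2 ≤ Real.log (poch p a) := by
  rw [log_poch hp, ← sum_Ioc_cast, sum_mul]
  have : (a : ℝ) * Real.log 2 = ∑ j ∈ Ioc 0 a, Real.log 2 := by simp
  rw [this, ← sum_sub_distrib]
  exact sum_le_sum fun j hj => le_log_pow_sub_one hp (mem_Ioc.1 hj).1

/-! ### The size of the least common multiple of `p - 1, …, p ^ n - 1` -/

/-- `∑_{l ≤ n} log Φ_l(p)`, the logarithm of the polynomial least common multiple of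
`X - 1, …, X ^ n - 1` evaluated at `p`. -/
noncomputable def logLcm (p n : ℕ) : ℝ := ∑ l ∈ Ioc 0 n, Real.log (cyc p l)

open ArithmeticFunction ArithmeticFunction.Moebius in
lemma logLcm_eq_sum (hp : 2 ≤ p) (n : ℕ) :
    logLcm p n = ∑ d ∈ Ioc 0 n, (μ d : ℝ) * Real.log (poch p (n / d)) := by
  let g : ArithmeticFunction ℝ := ⟨fun m => Real.log ((p : ℝ) ^ m - 1), by simp⟩
  have hg : ∀ m > 0, ∑ l ∈ m.divisors, Real.log (cyc p l) = g m := by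
    intro m hm
    rw [← Real.log_prod fun l _ => (cyc_pos hp l).ne', prod_divisors_cyc p hm]; rfl
  have h := (ArithmeticFunction.sum_eq_iff_sum_mul_moebius_eq).1 hg
  have h2 := ArithmeticFunction.sum_Ioc_mul_eq_sum_sum ((μ : ArithmeticFunction ℤ) : ArithmeticFunction ℝ) g n
  rw [logLcm]
  calc _ = ∑ l ∈ Ioc 0 n, (((μ : ArithmeticFunction ℤ) : ArithmeticFunction ℝ) * g) l := by
        refine sum_congr rfl fun l hl => ?_
        rw [← h l (mem_Ioc.1 hl).1, ArithmeticFunction.mul_apply]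
        simp
    _ = _ := by
        rw [h2]
        refine sum_congr rfl fun d _ => ?_
        rw [log_poch hp]
        simp [g]

open ArithmeticFunction ArithmeticFunction.Moebius in
lemma tsum_moebius_div_sq : ∑' d : ℕ, (μ d : ℝ) / (d : ℝ) ^ 2 = 6 / Real.pi ^ 2 := by
  have h := LSeries_one_mul_Lseries_moebius (s := 2) (by norm_num)
  rw [LSeries_one_eq_riemannZeta (by norm_num), riemannZeta_two] at h
  have h2 : LSeries (fun n => ((μ n : ℤ) : ℂ)) 2 = ((∑' d : ℕ, (μ d : ℝ) / (d : ℝ) ^ 2 : ℝ) : ℂ) := by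
    rw [LSeries, Complex.ofReal_tsum]
    refine tsum_congr fun d => ?_
    rw [LSeries.term_def]
    split_ifs with hd
    · simp [hd]
    · push_cast
      congr 1
      exact_mod_cast Complex.cpow_natCast (d : ℂ) 2
  rw [h2] at h
  have hpi : (Real.pi : ℝ) ≠ 0 := Real.pi_ne_zero
  have h3 : Real.pi ^ 2 / 6 * (∑' d : ℕ, (μ d : ℝ) / (d : ℝ) ^ 2) = 1 := by exact_mod_cast h
  field_simp at h3 ⊢
  linarith

open ArithmeticFunction ArithmeticFunction.Moebius in
/-- The `q`-analogue of the prime number theorem: it is elementary because `log Φ_l(p)` is the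
Möbius inverse of `log (p ^ n - 1) ≈ n log p`. -/
lemma tendsto_logLcm (hp : 2 ≤ p) :
    Tendsto (fun n : ℕ => logLcm p n / (n : ℝ) ^ 2) atTop
      (𝓝 (3 / Real.pi ^ 2 * Real.log p)) := by
  have hL : 0 < Real.log p := Real.log_pos (one_lt_cast hp)
  have hsum : ∀ n : ℕ, logLcm p n / (n : ℝ) ^ 2 =
      ∑' d : ℕ, (μ d : ℝ) * Real.log (poch p (n / d)) / (n : ℝ) ^ 2 := by
    intro n
    rw [logLcm_eq_sum hp, sum_div, tsum_eq_sum]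
    intro d hd
    rw [mem_Ioc, not_and_or, not_lt, not_le] at hd
    rcases hd with hd | hd
    · obtain rfl : d = 0 := by omega
      simp
    · simp [Nat.div_eq_of_lt hd, poch]
  have hlim : ∑' d : ℕ, (μ d : ℝ) * (Real.log p / 2 / (d : ℝ) ^ 2) =
      3 / Real.pi ^ 2 * Real.log p := by
    calc _ = ∑' d : ℕ, (μ d : ℝ) / (d : ℝ) ^ 2 * (Real.log p / 2) := tsum_congr fun d => by ring
      _ = _ := by rw [tsum_mul_right, tsum_moebius_div_sq]; ring
  simp_rw [hsum, ← hlim]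
  have hmu : ∀ d : ℕ, |(μ d : ℝ)| ≤ 1 := fun d => by exact_mod_cast abs_moebius_le_one
  have hlow : ∀ a : ℕ, (a : ℝ) ^ 2 / 2 * Real.log p - a * Real.log 2 ≤ Real.log (poch p a) := by
    intro a
    refine le_trans ?_ (le_log_poch hp a)
    have : (0 : ℝ) ≤ a * Real.log p := by positivity
    nlinarith
  refine tendsto_tsum_of_dominated_convergence
    (bound := fun d : ℕ => (Real.log p + Real.log 2) * (1 / (d : ℝ) ^ 2)) ?_ ?_ ?_
  · exact (Real.summable_one_div_nat_pow.2 (by norm_num)).mul_left _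
  · intro d
    rcases Nat.eq_zero_or_pos d with rfl | hd
    · simp
    simp_rw [mul_div_assoc]
    refine Tendsto.const_mul _ ?_
    have hdiv : Tendsto (fun n : ℕ => ((n / d : ℕ) : ℝ) / n) atTop (𝓝 (1 / (d : ℝ))) := by
      have := (tendsto_nat_floor_mul_div_atTop (R := ℝ) (a := 1 / (d : ℝ)) (by positivity)).comp
        (tendsto_natCast_atTop_atTop (R := ℝ))
      refine this.congr fun n => ?_
      simp only [Function.comp]
      rw [one_div_mul_eq_div, Nat.floor_div_eq_div]
    have hinv : Tendsto (fun n : ℕ => 1 / (n : ℝ)) atTop (𝓝 0) := tendsto_one_div_atTop_nhds_zero_nat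
    have e1 : Tendsto (fun n : ℕ => (((n / d : ℕ) : ℝ) / n) ^ 2 / 2 * Real.log p
        - ((n / d : ℕ) : ℝ) / n * (1 / n) * Real.log 2) atTop
        (𝓝 (Real.log p / 2 / (d : ℝ) ^ 2)) := by
      have := (((hdiv.pow 2).div_const 2).mul_const (Real.log p)).sub
        ((hdiv.mul hinv).mul_const (Real.log 2))
      convert this using 2
      ring
    have e2 : Tendsto (fun n : ℕ => ((((n / d : ℕ) : ℝ) / n) ^ 2
        + ((n / d : ℕ) : ℝ) / n * (1 / n)) / 2 * Real.log p) atTop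
        (𝓝 (Real.log p / 2 / (d : ℝ) ^ 2)) := by
      have := ((((hdiv.pow 2)).add (hdiv.mul hinv)).div_const 2).mul_const (Real.log p)
      convert this using 2
      ring
    refine tendsto_of_tendsto_of_tendsto_of_le_of_le' e1 e2 ?_ ?_
    · filter_upwards [eventually_gt_atTop 0] with n hn
      have hn' : (0 : ℝ) < n := by exact_mod_cast hn
      rw [le_div_iff₀ (by positivity)]
      refine le_trans (le_of_eq ?_) (hlow (n / d))
      field_simp
    · filter_upwards [eventually_gt_atTop 0] with n hn
      have hn' : (0 : ℝ) < n := by exact_mod_cast hn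
      rw [div_le_iff₀ (by positivity)]
      refine le_trans (log_poch_le hp (n / d)) (le_of_eq ?_)
      field_simp
  · filter_upwards [eventually_gt_atTop 0] with n hn d
    have hn' : (0 : ℝ) < n := by exact_mod_cast hn
    rcases Nat.eq_zero_or_pos d with rfl | hd
    · simp
    have hd' : (0 : ℝ) < d := by exact_mod_cast hd
    set a := n / d with ha
    have had : (a : ℝ) ≤ n / d := by
      rw [ha]; exact Nat.cast_div_le
    have haa : (a : ℝ) ≤ (a : ℝ) ^ 2 := by
      exact_mod_cast Nat.le_self_pow (by norm_num) a
    have hl2 : 0 < Real.log 2 := Real.log_pos (by norm_num)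
    have hb : |Real.log (poch p a)| ≤ (Real.log p + Real.log 2) * (a : ℝ) ^ 2 := by
      rw [abs_le]
      constructor
      · refine le_trans ?_ (hlow a)
        nlinarith [sq_nonneg (a : ℝ), mul_nonneg (sq_nonneg (a : ℝ)) hL.le]
      · refine le_trans (log_poch_le hp a) ?_
        nlinarith [sq_nonneg (a : ℝ), mul_nonneg (sq_nonneg (a : ℝ)) hl2.le]
    rw [norm_div, norm_mul, Real.norm_eq_abs, Real.norm_eq_abs, Real.norm_eq_abs,
      abs_of_pos (a := (n : ℝ) ^ 2) (by positivity), div_le_iff₀ (by positivity)]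
    calc |(μ d : ℝ)| * |Real.log (poch p a)|
        ≤ 1 * ((Real.log p + Real.log 2) * (n / d : ℝ) ^ 2) := by
          refine mul_le_mul (hmu d) (hb.trans ?_) (abs_nonneg _) zero_le_one
          gcongr
      _ = _ := by field_simp

end

section

/-! ### Partial fractions with simple and double poles -/

section PartialFractions

open Polynomial

variable {K ι : Type*} [Field K]

/-- The linear polynomial `1 - z X`, whose root is `z⁻¹`. -/
noncomputable def lin (z : K) : K[X] := 1 - C z * X

@[simp] lemma eval_lin (z x : K) : (lin z).eval x = 1 - z * x := by simp [lin]

lemma lin_eq {z : K} (hz : z ≠ 0) : lin z = C (-z) * (X - C z⁻¹) := by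
  rw [lin, mul_sub, ← C_mul, neg_mul, mul_inv_cancel₀ hz]
  simp only [C_neg, C_1]; ring

lemma degree_lin {z : K} (hz : z ≠ 0) : (lin z).degree = 1 := by
  rw [lin_eq hz, degree_C_mul (neg_ne_zero.2 hz), degree_X_sub_C]

lemma lin_dvd {z : K} (hz : z ≠ 0) {G : K[X]} (h : G.eval z⁻¹ = 0) : lin z ∣ G := by
  rw [lin_eq hz, (isUnit_C.2 (neg_ne_zero.2 hz).isUnit).mul_left_dvd]
  exact dvd_iff_isRoot.2 h

lemma lin_mul_lin_dvd {z : K} (hz : z ≠ 0) {G : K[X]} (h : G.eval z⁻¹ = 0)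
    (h' : (derivative G).eval z⁻¹ = 0) : lin z * lin z ∣ G := by
  obtain ⟨H, rfl⟩ := lin_dvd hz h
  refine mul_dvd_mul_left _ (lin_dvd hz ?_)
  have : -z * H.eval z⁻¹ = 0 := by simpa [derivative_mul, lin, hz] using h'
  simpa [hz] using this

lemma isCoprime_lin {z w : K} (hz : z ≠ 0) (hw : w ≠ 0) (h : z ≠ w) :
    IsCoprime (lin z) (lin w) := by
  have hu : ∀ {u : K}, u ≠ 0 → IsUnit (C (-u)) := fun hu => isUnit_C.2 (neg_ne_zero.2 hu).isUnit
  rw [lin_eq hz, lin_eq hw, isCoprime_mul_unit_left_left (hu hz),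
    isCoprime_mul_unit_left_right (hu hw)]
  exact isCoprime_X_sub_C_of_isUnit_sub (sub_ne_zero.2 fun e => h (inv_injective e)).isUnit

/-- The common denominator `∏_{i ∈ S} (1 - z_i X) ∏_{i ∈ D} (1 - z_i X)`; for `D ⊆ S` it has a
double root for `i ∈ D` and a simple one for `i ∈ S \ D`. -/
noncomputable def den (z : ι → K) (S D : Finset ι) : K[X] :=
  (∏ i ∈ S, lin (z i)) * ∏ i ∈ D, lin (z i)

variable {z : ι → K} {S D : Finset ι}

lemma degree_den (hz : ∀ i, z i ≠ 0) : (den z S D).degree = ((#S + #D : ℕ) : WithBot ℕ) := by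
  have h : ∀ S : Finset ι, (∏ i ∈ S, lin (z i)).degree = ((#S : ℕ) : WithBot ℕ) := fun S => by
    rw [degree_prod, sum_congr rfl fun i _ => degree_lin (hz i)]; simp
  rw [den, degree_mul, h, h]; rfl

variable [DecidableEq ι]

/-- The common denominator `den z S D` without the factors that belong to `k`. -/
noncomputable def cofactor (z : ι → K) (S D : Finset ι) (k : ι) : K[X] :=
  den z (S.erase k) (D.erase k)

lemma den_eq_of_mem_of_mem {k : ι} (hS : k ∈ S) (hD : k ∈ D) :
    den z S D = lin (z k) * lin (z k) * cofactor z S D k := by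
  rw [den, cofactor, den, ← mul_prod_erase S _ hS, ← mul_prod_erase D _ hD]; ring

lemma den_eq_of_mem_of_notMem {k : ι} (hS : k ∈ S) (hD : k ∉ D) :
    den z S D = lin (z k) * cofactor z S D k := by
  rw [den, cofactor, den, ← mul_prod_erase S _ hS, erase_eq_of_notMem hD]; ring

lemma den_dvd (hz : ∀ i, z i ≠ 0) (hinj : Function.Injective z) (hDS : D ⊆ S) {Q : K[X]}
    (h1 : ∀ k ∈ S, Q.eval (z k)⁻¹ = 0) (h2 : ∀ k ∈ D, (derivative Q).eval (z k)⁻¹ = 0) :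
    den z S D ∣ Q := by
  have hden : den z S D = ∏ i ∈ S, lin (z i) * (if i ∈ D then lin (z i) else 1) := by
    rw [prod_mul_distrib, den, ← prod_filter, filter_mem_eq_inter, inter_eq_right.2 hDS]
  rw [hden]
  refine Finset.prod_dvd_of_coprime (fun i _ j _ hij => ?_) fun i hi => ?_
  · have hc : IsCoprime (lin (z i)) (lin (z j)) := isCoprime_lin (hz i) (hz j) (hinj.ne hij)
    have h : ∀ k : ι, lin (z k) * (if k ∈ D then lin (z k) else 1) =
        lin (z k) ^ (if k ∈ D then 2 else 1) := by
      intro k; split_ifs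
      · ring
      · ring
    simp only [Function.onFun, h]
    exact hc.pow
  · split_ifs with hD
    · exact lin_mul_lin_dvd (hz i) (h1 i hi) (h2 i hD)
    · rw [mul_one]; exact lin_dvd (hz i) (h1 i hi)

/-- Partial fraction expansion, cleared of denominators: Hermite interpolation of `P` at the roots
of `den z S D`. The double pole at `(z k)⁻¹` contributes
`a k * (z k X) / (1 - z k X) ^ 2 + c k / (1 - z k X)`. -/
lemma eq_sum_cofactor (hz : ∀ i, z i ≠ 0) (hinj : Function.Injective z) (hDS : D ⊆ S) {P : K[X]}
    (hP : P.degree < ((#S + #D : ℕ) : WithBot ℕ)) {a c : ι → K}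
    (hs : ∀ k ∈ S \ D, P.eval (z k)⁻¹ = c k * (cofactor z S D k).eval (z k)⁻¹)
    (hd : ∀ k ∈ D, P.eval (z k)⁻¹ = a k * (cofactor z S D k).eval (z k)⁻¹)
    (hd' : ∀ k ∈ D, (derivative P).eval (z k)⁻¹ =
      (a k - c k) * z k * (cofactor z S D k).eval (z k)⁻¹ +
        a k * (derivative (cofactor z S D k)).eval (z k)⁻¹) :
    P = ∑ k ∈ S \ D, C (c k) * cofactor z S D k +
      ∑ k ∈ D, (C (a k * z k) * X + C (c k) * lin (z k)) * cofactor z S D k := by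
  set R := ∑ k ∈ S \ D, C (c k) * cofactor z S D k +
      ∑ k ∈ D, (C (a k * z k) * X + C (c k) * lin (z k)) * cofactor z S D k with hR
  have hcop1 : ∀ m ∈ S, ∀ k, k ≠ m → lin (z m) ∣ cofactor z S D k := fun m hm k hk =>
    dvd_mul_of_dvd_left (dvd_prod_of_mem _ (mem_erase.2 ⟨hk.symm, hm⟩)) _
  have hcop2 : ∀ m ∈ D, ∀ k, k ≠ m → lin (z m) * lin (z m) ∣ cofactor z S D k :=
    fun m hm k hk => mul_dvd_mul
      (dvd_prod_of_mem (fun i => lin (z i)) (mem_erase.2 ⟨hk.symm, hDS hm⟩))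
      (dvd_prod_of_mem (fun i => lin (z i)) (mem_erase.2 ⟨hk.symm, hm⟩))
  have ev1 : ∀ m ∈ S, ∀ k, k ≠ m → (cofactor z S D k).eval (z m)⁻¹ = 0 := by
    intro m hm k hk
    obtain ⟨G, hG⟩ := hcop1 m hm k hk
    simp [hG, hz m]
  have ev2 : ∀ m ∈ D, ∀ k, k ≠ m → (derivative (cofactor z S D k)).eval (z m)⁻¹ = 0 := by
    intro m hm k hk
    obtain ⟨G, hG⟩ := hcop2 m hm k hk
    simp [hG, hz m, derivative_mul]
  have hval : ∀ m ∈ S, (P - R).eval (z m)⁻¹ = 0 := by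
    intro m hm
    rw [eval_sub, hR, eval_add, eval_finsetSum, eval_finsetSum, sub_eq_zero]
    by_cases hmD : m ∈ D
    · rw [sum_eq_zero, zero_add, sum_eq_single_of_mem m hmD, hd m hmD]
      · simp [hz m]
      · intro k _ hk
        rw [eval_mul, ev1 m hm k hk, mul_zero]
      · intro k hk
        rw [eval_mul, ev1 m hm k, mul_zero]
        rintro rfl
        exact (mem_sdiff.1 hk).2 hmD
    · have hmS : m ∈ S \ D := mem_sdiff.2 ⟨hm, hmD⟩
      rw [sum_eq_single_of_mem m hmS, sum_eq_zero, add_zero, hs m hmS]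
      · simp
      · intro k hk
        rw [eval_mul, ev1 m hm k, mul_zero]
        rintro rfl
        exact hmD hk
      · intro k _ hk
        rw [eval_mul, ev1 m hm k hk, mul_zero]
  have hder : ∀ m ∈ D, (derivative (P - R)).eval (z m)⁻¹ = 0 := by
    intro m hmD
    have hm := hDS hmD
    rw [derivative_sub, eval_sub, hR, derivative_add, derivative_sum, derivative_sum, eval_add,
      eval_finsetSum, eval_finsetSum, sub_eq_zero]
    rw [sum_eq_zero, zero_add, sum_eq_single_of_mem m hmD, hd' m hmD]
    · simp only [derivative_mul, derivative_add, derivative_C, zero_mul, derivative_X, mul_one,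
        zero_add, lin, derivative_sub, derivative_one, zero_sub, eval_add, eval_mul, eval_C,
        eval_neg, eval_X, eval_sub, eval_one, mul_inv_cancel₀ (hz m), mul_assoc]
      ring
    · intro k hk hkm
      rw [derivative_mul, eval_add, eval_mul, eval_mul, ev1 m hm k hkm, ev2 m hmD k hkm]
      ring
    · intro k hk
      have hkm : k ≠ m := by
        rintro rfl
        exact (mem_sdiff.1 hk).2 hmD
      rw [derivative_mul, eval_add, eval_mul, eval_mul, ev1 m hm k hkm, ev2 m hmD k hkm]
      ring
  have hdvd := den_dvd hz hinj hDS hval hder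
  refine sub_eq_zero.1 (eq_zero_of_dvd_of_degree_lt hdvd ?_)
  rw [degree_den hz]
  refine lt_of_le_of_lt (degree_sub_le _ _) (max_lt hP ?_)
  have hlt : ∀ {f g : K[X]}, f.degree < ((#S + #D : ℕ) : WithBot ℕ) →
      g.degree < ((#S + #D : ℕ) : WithBot ℕ) → (f + g).degree < ((#S + #D : ℕ) : WithBot ℕ) :=
    fun hf hg => (degree_add_le _ _).trans_lt (max_lt hf hg)
  have hsum : ∀ {T : Finset ι} {f : ι → K[X]}, (∀ k ∈ T, (f k).degree < ((#S + #D : ℕ) : WithBot ℕ))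
      → (∑ k ∈ T, f k).degree < ((#S + #D : ℕ) : WithBot ℕ) := fun h =>
    (degree_sum_le _ _).trans_lt ((Finset.sup_lt_iff (WithBot.bot_lt_coe _)).2 h)
  have hcof : ∀ k, (cofactor z S D k).degree = ((#(S.erase k) + #(D.erase k) : ℕ) : WithBot ℕ) :=
    fun k => degree_den hz
  refine hlt (hsum fun k hk => ?_) (hsum fun k hk => ?_)
  · refine (degree_mul_le _ _).trans_lt ?_
    have hkS := (mem_sdiff.1 hk).1
    have : #(S.erase k) + #(D.erase k) < #S + #D :=
      add_lt_add_of_lt_of_le (card_erase_lt_of_mem hkS) (card_le_card (erase_subset _ _))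
    calc _ ≤ 0 + (cofactor z S D k).degree := by gcongr; exact degree_C_le
      _ < _ := by rw [zero_add, hcof]; exact_mod_cast this
  · have hkS := hDS hk
    have h1 := card_erase_of_mem hkS
    have h2 := card_erase_of_mem hk
    have h3 := card_pos.2 ⟨k, hkS⟩
    have h4 := card_pos.2 ⟨k, hk⟩
    have : 1 + (#(S.erase k) + #(D.erase k)) < #S + #D := by omega
    refine (degree_mul_le _ _).trans_lt ?_
    calc _ ≤ 1 + (cofactor z S D k).degree := by
          gcongr
          refine (degree_add_le _ _).trans (max_le ?_ ?_)
          · exact (degree_C_mul_X_le _)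
          · refine (degree_mul_le _ _).trans ?_
            rw [degree_lin (hz k)]
            calc _ ≤ (0 : WithBot ℕ) + 1 := by gcongr; exact degree_C_le
              _ = 1 := zero_add 1
      _ < _ := by rw [hcof]; exact_mod_cast this

lemma div_den_eq_sum {P : K[X]} (hDS : D ⊆ S) {a c : ι → K}
    (h : P = ∑ k ∈ S \ D, C (c k) * cofactor z S D k +
      ∑ k ∈ D, (C (a k * z k) * X + C (c k) * lin (z k)) * cofactor z S D k)
    {T : K} (hT : ∀ i ∈ S, 1 - z i * T ≠ 0) :
    P.eval T / (den z S D).eval T =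
      ∑ k ∈ D, a k * (z k * T / (1 - z k * T) ^ 2) + ∑ k ∈ S, c k * (1 / (1 - z k * T)) := by
  have hprod : ∀ U ⊆ S, (∏ i ∈ U, lin (z i)).eval T ≠ 0 := fun U hU => by
    rw [eval_prod]; exact prod_ne_zero_iff.2 fun i hi => by simpa using hT i (hU hi)
  have hcof : ∀ k, (cofactor z S D k).eval T ≠ 0 := fun k => by
    rw [cofactor, den, eval_mul]
    exact mul_ne_zero (hprod _ (erase_subset _ _)) (hprod _ ((erase_subset _ _).trans hDS))
  conv_lhs => rw [h]
  rw [eval_add, eval_finsetSum, eval_finsetSum, add_div, sum_div, sum_div, ← sum_sdiff hDS]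
  rw [add_comm (∑ k ∈ S \ D, c k * _), ← add_assoc, ← sum_add_distrib, add_comm]
  congr 1
  · refine sum_congr rfl fun k hk => ?_
    have h1 := hT k (hDS hk)
    have h2 := hcof k
    rw [den_eq_of_mem_of_mem (hDS hk) hk]
    simp only [eval_mul, eval_add, eval_C, eval_X, eval_lin]
    field_simp
  · refine sum_congr rfl fun k hk => ?_
    have h1 := hT k (mem_sdiff.1 hk).1
    have h2 := hcof k
    rw [den_eq_of_mem_of_notMem (mem_sdiff.1 hk).1 (mem_sdiff.1 hk).2]
    simp only [eval_mul, eval_C, eval_lin]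
    field_simp

/-- Logarithmic derivative of a product of linear polynomials. -/
lemma mul_eval_derivative_prod_lin (w : ι → K) (U : Finset ι) {y : K}
    (h : ∀ i ∈ U, w i * y ≠ 1) :
    y * (derivative (∏ i ∈ U, lin (w i))).eval y =
      (∏ i ∈ U, lin (w i)).eval y * ∑ i ∈ U, w i * y / (w i * y - 1) := by
  classical
  induction U using Finset.induction_on with
  | empty => simp
  | insert i U hi ih =>
    have ih := ih fun j hj => h j (mem_insert_of_mem hj)
    have h1 : w i * y - 1 ≠ 0 := sub_ne_zero.2 (h i (mem_insert_self _ _))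
    rw [prod_insert hi, sum_insert hi, derivative_mul, eval_add, eval_mul, eval_mul, eval_mul,
      mul_add, mul_left_comm y ((lin (w i)).eval y), ih]
    have h2 : (derivative (lin (w i))).eval y = -w i := by simp [lin]
    rw [h2, eval_lin]
    linear_combination (∏ i ∈ U, lin (w i)).eval y * div_mul_cancel₀ (w i * y) h1

end PartialFractions

end

section

/-! ### The linear forms -/

lemma hasSum_qZeta_two {r : ℝ} (h0 : 0 ≤ r) (h1 : r < 1) :
    HasSum (fun t : ℕ => r ^ (t + 1) / (1 - r ^ (t + 1)) ^ 2) (qZeta r 2) := by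
  have hr : ‖r‖ < 1 := by rwa [Real.norm_eq_abs, abs_of_nonneg h0]
  have hs := summable_prod_mul_pow (𝕜 := ℝ) 1 hr
  have hq : qZeta r 2 = ∑' c : ℕ+ × ℕ+, (c.2 : ℝ) ^ 1 * r ^ (c.1 * c.2 : ℕ) := by
    rw [hs.tsum_prod, tsum_prod_pow_eq_tsum_sigma 1 hr, ← tsum_pow_div_one_sub_eq_tsum_sigma hr 1]
    rfl
  have hfib : ∀ d : ℕ+, HasSum (fun c : ℕ+ => (c : ℝ) ^ 1 * r ^ (d * c : ℕ))
      (r ^ (d : ℕ) / (1 - r ^ (d : ℕ)) ^ 2) := by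
    intro d
    have hd : ‖r ^ (d : ℕ)‖ < 1 := by
      rw [norm_pow]; exact pow_lt_one₀ (norm_nonneg _) hr d.pos.ne'
    have h := hasSum_coe_mul_geometric_of_norm_lt_one hd
    rw [← hasSum_nat_add_iff' 1] at h
    rw [← Equiv.pnatEquivNat.symm.hasSum_iff]
    simpa [Function.comp_def, pow_mul] using h
  have h := hs.hasSum.prod_fiberwise hfib
  rw [← hq, ← Equiv.pnatEquivNat.symm.hasSum_iff] at h
  simpa [Function.comp_def] using h

/-- The nodes `p ^ (-i)`. -/
noncomputable def node (p i : ℕ) : ℝ := ((p : ℝ) ^ i)⁻¹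

/-- The numerator `X ^ M (1 - p X) (1 - p ^ 2 X) ⋯ (1 - p ^ N X)`. -/
noncomputable def numer (p M N : ℕ) : Polynomial ℝ :=
  Polynomial.X ^ M * ∏ j ∈ Ioc 0 N, lin ((p : ℝ) ^ j)

/-- The denominator, with roots `1, p, …, p ^ N` of which `p ^ s, …, p ^ n` are double. -/
noncomputable def denom (p N s n : ℕ) : Polynomial ℝ := den (node p) (range (N + 1)) (Icc s n)

/-- The cofactor of the root `p ^ k` in `denom p N s n`. -/
noncomputable def cofac (p N s n k : ℕ) : Polynomial ℝ :=
  cofactor (node p) (range (N + 1)) (Icc s n) k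

/-- The leading partial fraction coefficient of `numer / denom` at the pole `p ^ k`. -/
noncomputable def coefA (p M N s n k : ℕ) : ℝ :=
  (numer p M N).eval ((p : ℝ) ^ k) / (cofac p N s n k).eval ((p : ℝ) ^ k)

/-- The value at `X = p ^ k` of the logarithmic derivative `X d/dX` of the quotient of the numerator
by the cofactor of `p ^ k` in the denominator. -/
noncomputable def logDer (p M N s n k : ℕ) : ℝ :=
  M + ∑ j ∈ Ioc 0 N, (p : ℝ) ^ j * (p : ℝ) ^ k / ((p : ℝ) ^ j * (p : ℝ) ^ k - 1)
    - (∑ i ∈ (range (N + 1)).erase k, node p i * (p : ℝ) ^ k / (node p i * (p : ℝ) ^ k - 1)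
      + ∑ i ∈ (Icc s n).erase k, node p i * (p : ℝ) ^ k / (node p i * (p : ℝ) ^ k - 1))

/-- The coefficient of `1 / (1 - x)`, with `x = p ^ (-k) X`, in the partial fraction expansion of
`numer / denom`, the double poles being written `coefA * x / (1 - x) ^ 2 + coefC / (1 - x)`. -/
noncomputable def coefC (p M N s n k : ℕ) : ℝ :=
  if k ∈ Icc s n then coefA p M N s n k * (1 - logDer p M N s n k) else coefA p M N s n k

variable {p : ℕ}

lemma node_pos (hp : 2 ≤ p) (i : ℕ) : 0 < node p i :=
  inv_pos.2 (pow_pos (zero_lt_one.trans (one_lt_cast hp)) _)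

lemma node_injective (hp : 2 ≤ p) : Function.Injective (node p) := fun _ _ h =>
  pow_right_injective₀ (zero_lt_one.trans (one_lt_cast hp)) (one_lt_cast hp).ne' (inv_injective h)

lemma inv_node (p i : ℕ) : (node p i)⁻¹ = (p : ℝ) ^ i := inv_inv _

lemma node_mul_pow_ne_one (hp : 2 ≤ p) {i k : ℕ} (h : i ≠ k) : node p i * (p : ℝ) ^ k ≠ 1 := by
  intro e
  refine h (node_injective hp ?_)
  rw [eq_inv_of_mul_eq_one_left e, node]

lemma pow_mul_pow_ne_one (hp : 2 ≤ p) {j k : ℕ} (h : 0 < j) : (p : ℝ) ^ j * (p : ℝ) ^ k ≠ 1 := by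
  rw [← pow_add]
  exact (one_lt_pow_cast hp (by omega)).ne'

lemma eval_cofac_ne_zero (hp : 2 ≤ p) (N s n k : ℕ) :
    (cofac p N s n k).eval ((p : ℝ) ^ k) ≠ 0 := by
  rw [cofac, cofactor, den, Polynomial.eval_mul, Polynomial.eval_prod, Polynomial.eval_prod]
  refine mul_ne_zero (prod_ne_zero_iff.2 fun i hi => ?_) (prod_ne_zero_iff.2 fun i hi => ?_) <;>
  · rw [eval_lin, sub_ne_zero]
    exact (node_mul_pow_ne_one hp (mem_erase.1 hi).1).symm

variable {M N s n : ℕ}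

lemma numer_eq_sum (hp : 2 ≤ p) (hsn : s ≤ n) (hnN : n ≤ N) (hM : M ≤ n - s + 1) :
    numer p M N = ∑ k ∈ range (N + 1) \ Icc s n,
        Polynomial.C (coefC p M N s n k) * cofac p N s n k +
      ∑ k ∈ Icc s n, (Polynomial.C (coefA p M N s n k * node p k) * Polynomial.X +
        Polynomial.C (coefC p M N s n k) * lin (node p k)) * cofac p N s n k := by
  have hp0 : (p : ℝ) ≠ 0 := (zero_lt_one.trans (one_lt_cast hp)).ne'
  have hA : ∀ k, (numer p M N).eval ((p : ℝ) ^ k) =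
      coefA p M N s n k * (cofac p N s n k).eval ((p : ℝ) ^ k) := fun k =>
    (div_mul_cancel₀ _ (eval_cofac_ne_zero hp N s n k)).symm
  refine eq_sum_cofactor (fun i => (node_pos hp i).ne') (node_injective hp) ?_ ?_ ?_ ?_ ?_
  · intro i hi
    rw [mem_Icc] at hi
    rw [mem_range]; omega
  · have h1 : (numer p M N).degree = ((M + N : ℕ) : WithBot ℕ) := by
      rw [numer, Polynomial.degree_mul, Polynomial.degree_X_pow, Polynomial.degree_prod,
        sum_congr rfl fun j _ => degree_lin (pow_ne_zero j hp0)]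
      simp
    rw [h1, card_range, Nat.card_Icc]
    exact_mod_cast (by omega : M + N < N + 1 + (n + 1 - s))
  · intro k hk
    rw [inv_node, hA, coefC, if_neg (mem_sdiff.1 hk).2]; rfl
  · intro k _
    rw [inv_node, hA]; rfl
  · intro k hk
    have hpk : (p : ℝ) ^ k ≠ 0 := pow_ne_zero k hp0
    rw [inv_node, coefC, if_pos hk, node]
    refine mul_left_cancel₀ hpk ?_
    have hnum : (p : ℝ) ^ k * (Polynomial.derivative (numer p M N)).eval ((p : ℝ) ^ k) =
        (numer p M N).eval ((p : ℝ) ^ k) *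
          (M + ∑ j ∈ Ioc 0 N, (p : ℝ) ^ j * (p : ℝ) ^ k / ((p : ℝ) ^ j * (p : ℝ) ^ k - 1)) := by
      have h := mul_eval_derivative_prod_lin (fun j : ℕ => (p : ℝ) ^ j) (Ioc 0 N)
        (y := (p : ℝ) ^ k) fun j hj => pow_mul_pow_ne_one hp (mem_Ioc.1 hj).1
      have hX : (p : ℝ) ^ k * (Polynomial.derivative (Polynomial.X ^ M : Polynomial ℝ)).eval
          ((p : ℝ) ^ k) = M * ((p : ℝ) ^ k) ^ M := by
        rcases M with _ | M
        · simp
        · rw [Polynomial.derivative_X_pow, Polynomial.eval_mul, Polynomial.eval_C,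
            Polynomial.eval_pow, Polynomial.eval_X, Nat.add_sub_cancel, pow_succ]
          ring
      rw [numer, Polynomial.derivative_mul, Polynomial.eval_add, Polynomial.eval_mul,
        Polynomial.eval_mul, Polynomial.eval_mul, mul_add, ← mul_assoc, hX,
        mul_left_comm ((p : ℝ) ^ k), h]
      simp only [Polynomial.eval_pow, Polynomial.eval_X]
      ring
    have hcof : (p : ℝ) ^ k * (Polynomial.derivative (cofac p N s n k)).eval ((p : ℝ) ^ k) =
        (cofac p N s n k).eval ((p : ℝ) ^ k) *
        (∑ i ∈ (range (N + 1)).erase k, node p i * (p : ℝ) ^ k / (node p i * (p : ℝ) ^ k - 1)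
          + ∑ i ∈ (Icc s n).erase k, node p i * (p : ℝ) ^ k / (node p i * (p : ℝ) ^ k - 1)) := by
      have h1 := mul_eval_derivative_prod_lin (node p) ((range (N + 1)).erase k)
        (y := (p : ℝ) ^ k) fun i hi => node_mul_pow_ne_one hp (mem_erase.1 hi).1
      have h2 := mul_eval_derivative_prod_lin (node p) ((Icc s n).erase k)
        (y := (p : ℝ) ^ k) fun i hi => node_mul_pow_ne_one hp (mem_erase.1 hi).1
      rw [cofac, cofactor, den, Polynomial.derivative_mul, Polynomial.eval_add,
        Polynomial.eval_mul, Polynomial.eval_mul, Polynomial.eval_mul, mul_add, ← mul_assoc, h1,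
        mul_left_comm ((p : ℝ) ^ k), h2]
      ring
    change _ = (p : ℝ) ^ k * ((coefA p M N s n k - coefA p M N s n k * (1 - logDer p M N s n k)) *
      ((p : ℝ) ^ k)⁻¹ * (cofac p N s n k).eval ((p : ℝ) ^ k) +
      coefA p M N s n k * (Polynomial.derivative (cofac p N s n k)).eval ((p : ℝ) ^ k))
    rw [mul_add, mul_left_comm _ (coefA p M N s n k) (Polynomial.eval _ _), hcof, hnum, hA, logDer]
    field_simp
    ring

lemma sum_coefC (hp : 2 ≤ p) (hsn : s ≤ n) (hnN : n ≤ N) (hM0 : 0 < M) (hM : M ≤ n - s + 1) :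
    ∑ k ∈ range (N + 1), coefC p M N s n k = 0 := by
  have hDS : Icc s n ⊆ range (N + 1) := fun i hi => by
    rw [mem_Icc] at hi
    rw [mem_range]; omega
  have h := div_den_eq_sum hDS (numer_eq_sum hp hsn hnN hM) (T := 0) (by simp)
  simpa [numer, hM0.ne'] using h.symm

/-- The partial sum `∑_{j ≤ k} 1 / (p ^ j - 1)`. -/
noncomputable def harm₁ (p k : ℕ) : ℝ := ∑ j ∈ Ioc 0 k, 1 / ((p : ℝ) ^ j - 1)

/-- The partial sum `∑_{j ≤ k} p ^ j / (p ^ j - 1) ^ 2`. -/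
noncomputable def harm₂ (p k : ℕ) : ℝ := ∑ j ∈ Ioc 0 k, (p : ℝ) ^ j / ((p : ℝ) ^ j - 1) ^ 2

lemma sum_Ioc_eq_sum_range {f : ℕ → ℝ} (k : ℕ) : ∑ j ∈ Ioc 0 k, f j = ∑ j ∈ range k, f (j + 1) := by
  induction k with
  | zero => simp
  | succ k ih =>
    rw [sum_range_succ, ← ih, ← Finset.insert_Ioc_right_eq_Ioc_add_one (Nat.zero_le k),
      sum_insert (by simp), add_comm]

lemma one_sub_node_pos (hp : 2 ≤ p) {j : ℕ} (hj : 0 < j) : 0 < 1 - node p j :=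
  sub_pos.2 (inv_lt_one_of_one_lt₀ (one_lt_pow_cast hp hj))

/-- The sum of `numer / denom` over the points `p ^ (-t)`, `t ≥ 1`, is a linear form
in `1` and `ζ_q(2)`. No `ζ_q(1)` appears because the residual coefficients add up to zero. -/
lemma hasSum_linearForm (hp : 2 ≤ p) (hsn : s ≤ n) (hnN : n ≤ N) (hM0 : 0 < M)
    (hM : M ≤ n - s + 1) :
    HasSum (fun t : ℕ => (numer p M N).eval (node p (t + 1)) /
        (denom p N s n).eval (node p (t + 1)))
      (∑ k ∈ Icc s n, coefA p M N s n k * (qZeta (1 / (p : ℝ)) 2 - harm₂ p k) -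
        ∑ k ∈ range (N + 1), coefC p M N s n k * harm₁ p k) := by
  have hp1 := one_lt_cast hp
  have hp0 : (0 : ℝ) < p := zero_lt_one.trans hp1
  have hDS : Icc s n ⊆ range (N + 1) := fun i hi => by
    rw [mem_Icc] at hi
    rw [mem_range]; omega
  have hmul : ∀ i j, node p i * node p j = node p (i + j) := fun i j => by
    rw [node, node, node, pow_add, mul_inv]
  have hζ : HasSum (fun t : ℕ => node p (t + 1) / (1 - node p (t + 1)) ^ 2)
      (qZeta (1 / (p : ℝ)) 2) := by
    have := hasSum_qZeta_two (r := 1 / (p : ℝ)) (by positivity) (by rw [div_lt_one hp0]; exact hp1)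
    simpa [node] using this
  have hsum1 : Summable (fun t : ℕ => node p (t + 1) / (1 - node p (t + 1))) := by
    refine Summable.of_nonneg_of_le (fun t => ?_) (fun t => ?_) hζ.summable
    · exact div_nonneg (node_pos hp _).le (one_sub_node_pos hp t.succ_pos).le
    · have h1 := one_sub_node_pos hp t.succ_pos
      have h2 := node_pos hp (t + 1)
      gcongr
      rw [sq]
      exact mul_le_of_le_one_left h1.le (by linarith)
  have hcl : ∀ j, 0 < j → node p j / (1 - node p j) = 1 / ((p : ℝ) ^ j - 1) ∧
      node p j / (1 - node p j) ^ 2 = (p : ℝ) ^ j / ((p : ℝ) ^ j - 1) ^ 2 := by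
    intro j hj
    have h1 : (p : ℝ) ^ j - 1 ≠ 0 := (sub_pos.2 (one_lt_pow_cast hp hj)).ne'
    have h2 : (p : ℝ) ^ j ≠ 0 := pow_ne_zero j hp0.ne'
    have h3 : 1 - node p j = ((p : ℝ) ^ j - 1) / (p : ℝ) ^ j := by
      rw [node]; field_simp
    rw [h3, node]
    constructor <;> field_simp
  have hA : ∀ k, HasSum (fun t : ℕ => node p k * node p (t + 1) /
      (1 - node p k * node p (t + 1)) ^ 2) (qZeta (1 / (p : ℝ)) 2 - harm₂ p k) := by
    intro k
    have h := (hasSum_nat_add_iff' k).2 hζ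
    have e : ∑ i ∈ range k, node p (i + 1) / (1 - node p (i + 1)) ^ 2 = harm₂ p k := by
      rw [harm₂, sum_Ioc_eq_sum_range]
      exact sum_congr rfl fun i _ => (hcl (i + 1) i.succ_pos).2
    rw [e] at h
    have e' : ∀ t, k + (t + 1) = t + k + 1 := fun t => by ring
    simpa only [hmul, e'] using h
  have hC : ∀ k, HasSum (fun t : ℕ => node p k * node p (t + 1) /
      (1 - node p k * node p (t + 1)))
      (∑' t : ℕ, node p (t + 1) / (1 - node p (t + 1)) - harm₁ p k) := by
    intro k
    have h := (hasSum_nat_add_iff' k).2 hsum1.hasSum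
    have e : ∑ i ∈ range k, node p (i + 1) / (1 - node p (i + 1)) = harm₁ p k := by
      rw [harm₁, sum_Ioc_eq_sum_range]
      exact sum_congr rfl fun i _ => (hcl (i + 1) i.succ_pos).1
    rw [e] at h
    have e' : ∀ t, k + (t + 1) = t + k + 1 := fun t => by ring
    simpa only [hmul, e'] using h
  have hne : ∀ (k t : ℕ), 1 - node p k * node p (t + 1) ≠ 0 := fun k t => by
    rw [hmul]; exact (one_sub_node_pos hp (by omega)).ne'
  have hC0 := sum_coefC hp hsn hnN hM0 hM
  have key := (hasSum_sum fun k (_ : k ∈ Icc s n) => (hA k).mul_left (coefA p M N s n k)).add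
    (hasSum_sum fun k (_ : k ∈ range (N + 1)) => (hC k).mul_left (coefC p M N s n k))
  have hval : ∑ k ∈ range (N + 1), coefC p M N s n k *
      (∑' t : ℕ, node p (t + 1) / (1 - node p (t + 1)) - harm₁ p k) =
      -∑ k ∈ range (N + 1), coefC p M N s n k * harm₁ p k := by
    simp_rw [mul_sub]
    rw [sum_sub_distrib, ← sum_mul, hC0]; ring
  rw [hval, ← sub_eq_add_neg] at key
  refine key.congr_fun fun t => ?_
  rw [denom, div_den_eq_sum hDS (numer_eq_sum hp hsn hnN hM) fun i _ => hne i t]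
  congr 1
  have h1 : ∀ k, 1 / (1 - node p k * node p (t + 1)) =
      1 + node p k * node p (t + 1) / (1 - node p k * node p (t + 1)) := fun k => by
    have := hne k t
    field_simp
    ring
  simp_rw [h1, mul_add, mul_one]
  rw [sum_add_distrib, hC0, zero_add]

end

section

/-! ### Exponents of the cyclotomic factors -/

/-- Exponent of `Φ_l` in the common denominator of the linear form with parameters
`N = 21 r`, `n = 20 r`, `s = r`: it is `2` for `l ≤ 20 r`, except for `1` when
`10 r < l ≤ 11 r`, then `1` for `20 r < l ≤ 21 r`, and `0` beyond. -/
def dexp (r l : ℕ) : ℤ :=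
  (if l ≤ 20 * r then 1 else 0) + (if l ≤ 21 * r then 1 else 0) + (if l ≤ 10 * r then 1 else 0)
    - (if l ≤ 11 * r then 1 else 0)

lemma div_add_div_le (a b l : ℕ) : a / l + b / l ≤ (a + b) / l :=
  Nat.div_add_div_le_add_div

lemma add_add_one_div_le {a b l : ℕ} (hl : 0 < l) : (a + b + 1) / l ≤ a / l + b / l + 1 := by
  refine Nat.lt_succ_iff.1 ((Nat.div_lt_iff_lt_mul hl).2 ?_)
  have h1 := Nat.div_add_mod a l
  have h2 := Nat.div_add_mod b l
  have h3 := Nat.mod_lt a hl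
  have h4 := Nat.mod_lt b hl
  nlinarith

lemma ite_dvd_le {l i : ℕ} (hi : 0 < i) :
    (if l ∣ i then (1 : ℤ) else 0) ≤ if l ≤ i then 1 else 0 := by
  split_ifs with h1 h2
  · exact le_rfl
  · exact absurd (Nat.le_of_dvd hi h1) h2
  · exact zero_le_one
  · exact le_rfl

/-- The integrality of the double-pole terms, factor by factor. For `10 r < l ≤ 11 r` the deficit
in `dexp` is made up by `Φ_l` dividing the product of `q`-binomial coefficients as soon
as `l ≤ k`. -/
lemma le_exponent_of_double {r k l i j : ℕ} (hrk : r ≤ k) (hk : k ≤ 20 * r) (hl : 0 < l)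
    (hi : 0 < i) (hi' : i ≤ 21 * r + k) (hj : 0 < j) (hj' : j ≤ k) :
    (if l ∣ i then (1 : ℤ) else 0) + (if l ∣ j then 1 else 0) ≤
      dexp r l + (((21 * r + k) / l : ℕ) - 2 * (k / l : ℕ) - ((21 * r - k) / l : ℕ)
        + ((19 * r) / l : ℕ) - ((k - r) / l : ℕ) - ((20 * r - k) / l : ℕ)) := by
  refine (add_le_add (ite_dvd_le hi) (ite_dvd_le hj)).trans ?_
  have b1 : k / l + k / l + (21 * r - k) / l ≤ (21 * r + k) / l := by
    refine (Nat.add_le_add_right (div_add_div_le _ _ _) _).trans ((div_add_div_le _ _ _).trans ?_)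
    exact Nat.div_le_div_right (by omega)
  have b2 : (k - r) / l + (20 * r - k) / l ≤ 19 * r / l := by
    refine (div_add_div_le _ _ _).trans (Nat.div_le_div_right (by omega))
  rcases Nat.lt_or_ge (21 * r) l with h | h
  · rw [Nat.div_eq_of_lt (a := k) (by omega), Nat.div_eq_of_lt (a := 21 * r - k) (by omega)] at *
    have b3 : l ≤ i → 1 ≤ (21 * r + k) / l := fun h' =>
      (Nat.le_div_iff_mul_le hl).2 (by omega)
    unfold dexp
    split_ifs <;> omega
  rcases Nat.lt_or_ge (11 * r) l with h1 | h1
  · unfold dexp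
    split_ifs <;> omega
  rcases Nat.lt_or_ge (10 * r) l with h2 | h2
  · rcases Nat.lt_or_ge k l with hkl | hkl
    · unfold dexp
      split_ifs <;> omega
    · have c1 : k / l = 1 := Nat.div_eq_of_lt_le (by omega) (by omega)
      have c2 : (20 * r - k) / l = 0 := Nat.div_eq_of_lt (by omega)
      have c3 : 1 ≤ 19 * r / l := (Nat.le_div_iff_mul_le hl).2 (by omega)
      have c4 : (k - r) / l < 2 := (Nat.div_lt_iff_lt_mul hl).2 (by omega)
      have c5 : (21 * r - k) / l < 2 := (Nat.div_lt_iff_lt_mul hl).2 (by omega)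
      have c6 : k - r < l → (k - r) / l = 0 := fun h => Nat.div_eq_of_lt h
      have c7 : 21 * r - k < l → (21 * r - k) / l = 0 := fun h => Nat.div_eq_of_lt h
      have c8 : 3 * l ≤ 21 * r + k → 3 ≤ (21 * r + k) / l := fun h =>
        (Nat.le_div_iff_mul_le hl).2 h
      have c9 : 2 ≤ (21 * r + k) / l := (Nat.le_div_iff_mul_le hl).2 (by omega)
      unfold dexp
      split_ifs <;> omega
  · unfold dexp
    split_ifs <;> omega

/-- Integrality at the simple poles `p ^ k`, `k < s`, factor by factor. -/
lemma le_exponent_of_lt {r k l j : ℕ} (hk : k < r) (hl : 0 < l) (hj : 0 < j) (hj' : j ≤ k) :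
    (if l ∣ j then (1 : ℤ) else 0) ≤
      dexp r l + (((21 * r + k) / l : ℕ) - 2 * (k / l : ℕ) - ((21 * r - k) / l : ℕ)
        + ((19 * r) / l : ℕ) + ((r - 1 - k) / l : ℕ) - ((20 * r - k) / l : ℕ)) := by
  refine (ite_dvd_le hj).trans ?_
  have b1 : k / l + k / l + (21 * r - k) / l ≤ (21 * r + k) / l := by
    refine (Nat.add_le_add_right (div_add_div_le _ _ _) _).trans ((div_add_div_le _ _ _).trans ?_)
    exact Nat.div_le_div_right (by omega)
  have b2 : (20 * r - k) / l ≤ 19 * r / l + (r - 1 - k) / l + 1 := by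
    rw [show 20 * r - k = 19 * r + (r - 1 - k) + 1 by omega]
    exact add_add_one_div_le hl
  have b3 : 20 * r < l → (20 * r - k) / l = 0 := fun h => Nat.div_eq_of_lt (by omega)
  generalize 19 * r / l = x at *
  generalize (r - 1 - k) / l = y at *
  unfold dexp
  split_ifs <;> omega

/-- Integrality at the simple poles `p ^ k`, `k > n`, factor by factor. -/
lemma le_exponent_of_gt {r k l j : ℕ} (hk : 20 * r < k) (hk' : k ≤ 21 * r) (hl : 0 < l)
    (hj : 0 < j) (hj' : j ≤ k) :
    (if l ∣ j then (1 : ℤ) else 0) ≤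
      dexp r l + (((21 * r + k) / l : ℕ) - 2 * (k / l : ℕ) - ((21 * r - k) / l : ℕ)
        + ((19 * r) / l : ℕ) + ((k - 20 * r - 1) / l : ℕ) - ((k - r) / l : ℕ)) := by
  refine (ite_dvd_le hj).trans ?_
  have b1 : k / l + k / l + (21 * r - k) / l ≤ (21 * r + k) / l := by
    refine (Nat.add_le_add_right (div_add_div_le _ _ _) _).trans ((div_add_div_le _ _ _).trans ?_)
    exact Nat.div_le_div_right (by omega)
  have b2 : (k - r) / l ≤ 19 * r / l + (k - 20 * r - 1) / l + 1 := by
    rw [show k - r = 19 * r + (k - 20 * r - 1) + 1 by omega]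
    exact add_add_one_div_le hl
  have b3 : 20 * r < l → (k - r) / l = 0 := fun h => Nat.div_eq_of_lt (by omega)
  have b4 : 10 * r < l → (k - r) / l < 2 := fun h => (Nat.div_lt_iff_lt_mul hl).2 (by omega)
  have b5 : l ≤ 19 * r → 1 ≤ 19 * r / l := fun h => (Nat.le_div_iff_mul_le hl).2 (by omega)
  generalize 19 * r / l = x at *
  generalize (k - 20 * r - 1) / l = y at *
  unfold dexp
  split_ifs <;> omega

end

section

/-! ### Closed forms of the partial fraction coefficients -/

/-- The triangular number `1 + 2 + ⋯ + a`. -/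
def tri (a : ℕ) : ℕ := ∑ j ∈ Ioc 0 a, j

lemma tri_succ (a : ℕ) : tri (a + 1) = tri a + (a + 1) := by
  rw [tri, tri, ← Finset.insert_Ioc_right_eq_Ioc_add_one (Nat.zero_le a), sum_insert (by simp),
    add_comm]

lemma two_mul_tri (a : ℕ) : 2 * tri a = a * (a + 1) := by
  induction a with
  | zero => simp [tri]
  | succ a ih => rw [tri_succ, mul_add, ih]; ring

variable {p : ℕ}

lemma abs_one_sub_node_mul_pow (hp : 2 ≤ p) {i k : ℕ} (h : i < k) :
    |1 - node p i * (p : ℝ) ^ k| = (p : ℝ) ^ (k - i) - 1 := by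
  have hp0 : (p : ℝ) ≠ 0 := (zero_lt_one.trans (one_lt_cast hp)).ne'
  have e : node p i * (p : ℝ) ^ k = (p : ℝ) ^ (k - i) := by
    rw [node, pow_sub₀ _ hp0 h.le, mul_comm]
  rw [e, abs_sub_comm, abs_of_pos (sub_pos.2 (one_lt_pow_cast hp (by omega)))]

lemma abs_one_sub_node_mul_pow' (hp : 2 ≤ p) {i k : ℕ} (h : k < i) :
    |1 - node p i * (p : ℝ) ^ k| = ((p : ℝ) ^ (i - k) - 1) / (p : ℝ) ^ (i - k) := by
  have hp0 : (p : ℝ) ≠ 0 := (zero_lt_one.trans (one_lt_cast hp)).ne'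
  have h1 := one_lt_pow_cast hp (j := i - k) (by omega)
  have e : node p i * (p : ℝ) ^ k = ((p : ℝ) ^ (i - k))⁻¹ := by
    rw [node, pow_sub₀ _ hp0 h.le, mul_inv, inv_inv]
  have e2 : 1 - ((p : ℝ) ^ (i - k))⁻¹ = ((p : ℝ) ^ (i - k) - 1) / (p : ℝ) ^ (i - k) := by
    field_simp
  rw [e, e2, abs_of_pos (div_pos (by linarith) (by linarith))]

lemma prod_Ico_abs (hp : 2 ≤ p) {a b k : ℕ} (hab : a ≤ b) (hbk : b ≤ k) :
    ∏ i ∈ Ico a b, |1 - node p i * (p : ℝ) ^ k| = poch p (k - a) / poch p (k - b) := by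
  induction b, hab using Nat.le_induction with
  | base => simp [(poch_pos hp _).ne']
  | succ b hab ih =>
    rw [prod_Ico_succ_top hab, ih (by omega), abs_one_sub_node_mul_pow hp (by omega),
      show k - b = k - (b + 1) + 1 by omega, poch_succ]
    have h1 := (poch_pos hp (k - (b + 1))).ne'
    have h2 : (p : ℝ) ^ (k - (b + 1) + 1) - 1 ≠ 0 :=
      (sub_pos.2 (one_lt_pow_cast hp (by omega))).ne'
    field_simp

lemma prod_Ioc_abs (hp : 2 ≤ p) {a b k : ℕ} (hka : k ≤ a) (hab : a ≤ b) :
    ∏ i ∈ Ioc a b, |1 - node p i * (p : ℝ) ^ k| =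
      (poch p (b - k) / (p : ℝ) ^ tri (b - k)) / (poch p (a - k) / (p : ℝ) ^ tri (a - k)) := by
  have hp0 : (p : ℝ) ≠ 0 := (zero_lt_one.trans (one_lt_cast hp)).ne'
  induction b, hab using Nat.le_induction with
  | base =>
    have h1 := (poch_pos hp (a - k)).ne'
    rw [Ioc_self, prod_empty, div_self (div_ne_zero h1 (pow_ne_zero _ hp0))]
  | succ b hab ih =>
    have hpow : ∀ m : ℕ, (p : ℝ) ^ m ≠ 0 := fun m => pow_ne_zero m hp0
    rw [← Finset.insert_Ioc_right_eq_Ioc_add_one hab, prod_insert (by simp), ih,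
      abs_one_sub_node_mul_pow' hp (by omega), show b + 1 - k = b - k + 1 by omega, poch_succ,
      tri_succ, pow_add _ (tri (b - k)) (b - k + 1)]
    have h1 := hpow (b - k + 1)
    have h2 := hpow (tri (b - k))
    field_simp

lemma prod_Ioc_abs_pow (hp : 2 ≤ p) (N k : ℕ) :
    ∏ j ∈ Ioc 0 N, |1 - (p : ℝ) ^ j * (p : ℝ) ^ k| = poch p (N + k) / poch p k := by
  induction N with
  | zero => simp [(poch_pos hp _).ne']
  | succ N ih =>
    rw [← Finset.insert_Ioc_right_eq_Ioc_add_one (Nat.zero_le N), prod_insert (by simp), ih,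
      ← pow_add, show N + 1 + k = N + k + 1 by omega, poch_succ, abs_sub_comm,
      abs_of_pos (sub_pos.2 (one_lt_pow_cast hp (by omega)))]
    ring

lemma abs_eval_numer (hp : 2 ≤ p) (M N k : ℕ) :
    |(numer p M N).eval ((p : ℝ) ^ k)| = (p : ℝ) ^ (k * M) * (poch p (N + k) / poch p k) := by
  rw [numer, Polynomial.eval_mul, abs_mul, Polynomial.eval_prod, abs_prod, ← prod_Ioc_abs_pow hp,
    Polynomial.eval_pow, Polynomial.eval_X, abs_of_pos (pow_pos
      (pow_pos (zero_lt_one.trans (one_lt_cast hp)) _) _), pow_mul]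
  simp only [eval_lin]

lemma prod_erase_Icc_abs (hp : 2 ≤ p) {a b k : ℕ} (hak : a ≤ k) (hkb : k ≤ b) :
    ∏ i ∈ (Icc a b).erase k, |1 - node p i * (p : ℝ) ^ k| =
      poch p (k - a) * (poch p (b - k) / (p : ℝ) ^ tri (b - k)) := by
  have e : (Icc a b).erase k = Ico a k ∪ Ioc k b := by
    ext i
    simp only [mem_erase, mem_Icc, mem_union, mem_Ico, mem_Ioc]
    omega
  have hd : Disjoint (Ico a k) (Ioc k b) := by
    rw [disjoint_left]
    intro i hi hi'
    rw [mem_Ico] at hi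
    rw [mem_Ioc] at hi'
    omega
  rw [e, prod_union hd, prod_Ico_abs hp hak le_rfl, prod_Ioc_abs hp le_rfl hkb]
  simp [poch, tri]

lemma abs_eval_cofac {N s n k : ℕ} :
    |(cofac p N s n k).eval ((p : ℝ) ^ k)| =
      (∏ i ∈ (Icc 0 N).erase k, |1 - node p i * (p : ℝ) ^ k|) *
        ∏ i ∈ (Icc s n).erase k, |1 - node p i * (p : ℝ) ^ k| := by
  rw [cofac, cofactor, den, Polynomial.eval_mul, abs_mul, Polynomial.eval_prod,
    Polynomial.eval_prod, abs_prod, abs_prod]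
  simp only [eval_lin]
  rw [Nat.range_eq_Icc_zero_sub_one _ (Nat.succ_ne_zero N), Nat.succ_sub_one]

variable {M N s n k : ℕ}

lemma abs_coefA_of_mem (hp : 2 ≤ p) (hsk : s ≤ k) (hkn : k ≤ n) (hnN : n ≤ N) :
    |coefA p M N s n k| = (p : ℝ) ^ (k * M + tri (N - k) + tri (n - k)) *
      (poch p (N + k) / (poch p k * poch p k * poch p (N - k) * poch p (k - s) *
        poch p (n - k))) := by
  have hp0 : (p : ℝ) ≠ 0 := (zero_lt_one.trans (one_lt_cast hp)).ne'
  rw [coefA, abs_div, abs_eval_numer hp, abs_eval_cofac,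
    prod_erase_Icc_abs hp (Nat.zero_le k) (hkn.trans hnN), prod_erase_Icc_abs hp hsk hkn,
    pow_add, pow_add, Nat.sub_zero]
  have h1 := (poch_pos hp k).ne'
  have h2 := (poch_pos hp (N - k)).ne'
  have h3 := (poch_pos hp (k - s)).ne'
  have h4 := (poch_pos hp (n - k)).ne'
  have hpow : ∀ m : ℕ, (p : ℝ) ^ m ≠ 0 := fun m => pow_ne_zero m hp0
  have h5 := hpow (tri (N - k))
  have h6 := hpow (tri (n - k))
  field_simp

lemma abs_coefA_of_lt (hp : 2 ≤ p) (hks : k < s) (hsn : s ≤ n) (hnN : n ≤ N) :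
    |coefA p M N s n k| * (p : ℝ) ^ tri (s - 1 - k) =
      (p : ℝ) ^ (k * M + tri (N - k) + tri (n - k)) *
      (poch p (N + k) * poch p (s - 1 - k) / (poch p k * poch p k * poch p (N - k) *
        poch p (n - k))) := by
  have hp0 : (p : ℝ) ≠ 0 := (zero_lt_one.trans (one_lt_cast hp)).ne'
  have e : (Icc s n).erase k = Ioc (s - 1) n := by
    ext i
    simp only [mem_erase, mem_Icc, mem_Ioc]
    omega
  rw [coefA, abs_div, abs_eval_numer hp, abs_eval_cofac,
    prod_erase_Icc_abs hp (Nat.zero_le k) (by omega), e, prod_Ioc_abs hp (by omega) (by omega),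
    pow_add, pow_add, Nat.sub_zero]
  have h1 := (poch_pos hp k).ne'
  have h2 := (poch_pos hp (N - k)).ne'
  have h3 := (poch_pos hp (s - 1 - k)).ne'
  have h4 := (poch_pos hp (n - k)).ne'
  have hpow : ∀ m : ℕ, (p : ℝ) ^ m ≠ 0 := fun m => pow_ne_zero m hp0
  have h5 := hpow (tri (N - k))
  have h6 := hpow (tri (n - k))
  have h7 := hpow (tri (s - 1 - k))
  field_simp

lemma abs_coefA_of_gt (hp : 2 ≤ p) (hsn : s ≤ n) (hnk : n < k) (hkN : k ≤ N) :
    |coefA p M N s n k| = (p : ℝ) ^ (k * M + tri (N - k)) *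
      (poch p (N + k) * poch p (k - n - 1) / (poch p k * poch p k * poch p (N - k) *
        poch p (k - s))) := by
  have hp0 : (p : ℝ) ≠ 0 := (zero_lt_one.trans (one_lt_cast hp)).ne'
  have e : (Icc s n).erase k = Ico s (n + 1) := by
    ext i
    simp only [mem_erase, mem_Icc, mem_Ico]
    omega
  rw [coefA, abs_div, abs_eval_numer hp, abs_eval_cofac,
    prod_erase_Icc_abs hp (Nat.zero_le k) (by omega), e, prod_Ico_abs hp (by omega) (by omega),
    pow_add, Nat.sub_zero, show k - (n + 1) = k - n - 1 by omega]
  have h1 := (poch_pos hp k).ne'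
  have h2 := (poch_pos hp (N - k)).ne'
  have h3 := (poch_pos hp (k - n - 1)).ne'
  have h4 := (poch_pos hp (k - s)).ne'
  have hpow : ∀ m : ℕ, (p : ℝ) ^ m ≠ 0 := fun m => pow_ne_zero m hp0
  have h5 := hpow (tri (N - k))
  field_simp

/-! ### Integrality -/

/-- The factor that clears the denominators of the linear form with parameters
`M = 19 r`, `N = 21 r`, `s = r`, `n = 20 r`. The power of `p` is common to all coefficients: it
bounds from below the exponents of `p` in them, which are least for `k` close to `11 r`. -/
noncomputable def scale (p r : ℕ) : ℝ :=
  cycProd p (42 * r) (dexp r) * poch p (19 * r) / (p : ℝ) ^ (299 * r ^ 2)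

lemma scale_pos (hp : 2 ≤ p) (r : ℕ) : 0 < scale p r :=
  div_pos (mul_pos (cycProd_pos hp _ _) (poch_pos hp _))
    (pow_pos (zero_lt_one.trans (one_lt_cast hp)) _)

lemma pow_div_pow_mem_intRange (hp : 2 ≤ p) {a b : ℕ} (h : b ≤ a) :
    (p : ℝ) ^ a / (p : ℝ) ^ b ∈ intRange := by
  have hp0 : (p : ℝ) ≠ 0 := (zero_lt_one.trans (one_lt_cast hp)).ne'
  rw [div_eq_mul_inv, ← pow_sub₀ _ hp0 h]
  exact pow_mem (natCast_mem_intRange p) _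

lemma scale_mul_coefA_div_mem (hp : 2 ≤ p) {r k i j : ℕ} (hrk : r ≤ k) (hk : k ≤ 20 * r)
    (hi : 0 < i) (hi' : i ≤ 21 * r + k) (hj : 0 < j) (hj' : j ≤ k) :
    scale p r * coefA p (19 * r) (21 * r) r (20 * r) k *
      (1 / ((p : ℝ) ^ i - 1) * (1 / ((p : ℝ) ^ j - 1))) ∈ intRange := by
  have hp0 : (p : ℝ) ≠ 0 := (zero_lt_one.trans (one_lt_cast hp)).ne'
  have hi1 : 0 < (p : ℝ) ^ i - 1 := sub_pos.2 (one_lt_pow_cast hp hi)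
  have hj1 : 0 < (p : ℝ) ^ j - 1 := sub_pos.2 (one_lt_pow_cast hp hj)
  rw [← abs_mem_intRange_iff, abs_mul, abs_mul, abs_of_pos (scale_pos hp r),
    abs_of_pos (mul_pos (one_div_pos.2 hi1) (one_div_pos.2 hj1)),
    abs_coefA_of_mem hp hrk hk (by omega), scale]
  have hE : 299 * r ^ 2 ≤ k * (19 * r) + tri (21 * r - k) + tri (20 * r - k) := by
    have h1 := two_mul_tri (21 * r - k)
    have h2 := two_mul_tri (20 * r - k)
    zify [show k ≤ 21 * r by omega, hk] at h1 h2 ⊢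
    have hr : (1 : ℤ) ≤ r := by omega
    -- The quadratic part is `(k - 11 r)² + 599 r² / 2`, its minimum being at `k = 11 r`.
    nlinarith [sq_nonneg ((k : ℤ) - 11 * r)]
  suffices h : (p : ℝ) ^ (k * (19 * r) + tri (21 * r - k) + tri (20 * r - k)) /
      (p : ℝ) ^ (299 * r ^ 2) * (cycProd p (42 * r) (dexp r) * poch p (19 * r) *
        poch p (21 * r + k) / (poch p k * poch p k * poch p (21 * r - k) * poch p (k - r) *
        poch p (20 * r - k) * (((p : ℝ) ^ i - 1) * ((p : ℝ) ^ j - 1)))) ∈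
        intRange by
    convert h using 1
    field_simp
  refine mul_mem (pow_div_pow_mem_intRange hp hE) ?_
  have hpoch : ∀ a ≤ 42 * r, poch p a = cycProd p (42 * r) fun l => ((a / l : ℕ) : ℤ) :=
    fun a ha => poch_eq_cycProd hp ha
  rw [hpoch (19 * r) (by omega), hpoch (21 * r + k) (by omega), hpoch k (by omega),
    hpoch (21 * r - k) (by omega), hpoch (k - r) (by omega), hpoch (20 * r - k) (by omega),
    pow_sub_one_eq_cycProd p (L := 42 * r) hi (by omega),
    pow_sub_one_eq_cycProd p (L := 42 * r) hj (by omega)]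
  simp only [cycProd_mul hp, cycProd_div hp]
  refine cycProd_mem_intRange fun l hl => ?_
  have := le_exponent_of_double hrk hk hl hi hi' hj hj'
  linarith

lemma scale_mul_coefA_div_mem_of_lt (hp : 2 ≤ p) {r k j : ℕ} (hk : k < r) (hj : 0 < j)
    (hj' : j ≤ k) :
    scale p r * coefA p (19 * r) (21 * r) r (20 * r) k * (1 / ((p : ℝ) ^ j - 1)) ∈ intRange := by
  have hp0 : (p : ℝ) ≠ 0 := (zero_lt_one.trans (one_lt_cast hp)).ne'
  have hj1 : 0 < (p : ℝ) ^ j - 1 := sub_pos.2 (one_lt_pow_cast hp hj)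
  have hA := abs_coefA_of_lt (M := 19 * r) (N := 21 * r) hp hk (show r ≤ 20 * r by omega) (by omega)
  rw [← abs_mem_intRange_iff, abs_mul, abs_mul, abs_of_pos (scale_pos hp r),
    abs_of_pos (one_div_pos.2 hj1), eq_div_of_mul_eq (pow_ne_zero _ hp0) hA, scale]
  have hE : 299 * r ^ 2 + tri (r - 1 - k) ≤
      k * (19 * r) + tri (21 * r - k) + tri (20 * r - k) := by
    have h1 := two_mul_tri (21 * r - k)
    have h2 := two_mul_tri (20 * r - k)
    have h3 := two_mul_tri (r - 1 - k)
    obtain ⟨c, rfl⟩ : ∃ c, r = k + 1 + c := ⟨r - 1 - k, by omega⟩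
    rw [show k + 1 + c - 1 - k = c by omega] at h3 ⊢
    zify [show k ≤ 21 * (k + 1 + c) by omega, show k ≤ 20 * (k + 1 + c) by omega] at h1 h2 h3 ⊢
    nlinarith
  suffices h : (p : ℝ) ^ (k * (19 * r) + tri (21 * r - k) + tri (20 * r - k)) /
      (p : ℝ) ^ (299 * r ^ 2 + tri (r - 1 - k)) * (cycProd p (42 * r) (dexp r) * poch p (19 * r) *
        poch p (21 * r + k) * poch p (r - 1 - k) / (poch p k * poch p k * poch p (21 * r - k) *
        poch p (20 * r - k) * ((p : ℝ) ^ j - 1))) ∈ intRange by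
    rw [pow_add _ (299 * r ^ 2)] at h
    convert h using 1
    field_simp
  refine mul_mem (pow_div_pow_mem_intRange hp hE) ?_
  have hpoch : ∀ a ≤ 42 * r, poch p a = cycProd p (42 * r) fun l => ((a / l : ℕ) : ℤ) :=
    fun a ha => poch_eq_cycProd hp ha
  rw [hpoch (19 * r) (by omega), hpoch (21 * r + k) (by omega), hpoch k (by omega),
    hpoch (21 * r - k) (by omega), hpoch (r - 1 - k) (by omega), hpoch (20 * r - k) (by omega),
    pow_sub_one_eq_cycProd p (L := 42 * r) hj (by omega)]
  simp only [cycProd_mul hp, cycProd_div hp]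
  refine cycProd_mem_intRange fun l hl => ?_
  have := le_exponent_of_lt hk hl hj hj'
  linarith

lemma scale_mul_coefA_div_mem_of_gt (hp : 2 ≤ p) {r k j : ℕ} (hk : 20 * r < k) (hk' : k ≤ 21 * r)
    (hj : 0 < j) (hj' : j ≤ k) :
    scale p r * coefA p (19 * r) (21 * r) r (20 * r) k * (1 / ((p : ℝ) ^ j - 1)) ∈ intRange := by
  have hp0 : (p : ℝ) ≠ 0 := (zero_lt_one.trans (one_lt_cast hp)).ne'
  have hj1 : 0 < (p : ℝ) ^ j - 1 := sub_pos.2 (one_lt_pow_cast hp hj)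
  rw [← abs_mem_intRange_iff, abs_mul, abs_mul, abs_of_pos (scale_pos hp r),
    abs_of_pos (one_div_pos.2 hj1), abs_coefA_of_gt hp (by omega) hk hk', scale]
  have hE : 299 * r ^ 2 ≤ k * (19 * r) + tri (21 * r - k) := by
    nlinarith
  suffices h : (p : ℝ) ^ (k * (19 * r) + tri (21 * r - k)) /
      (p : ℝ) ^ (299 * r ^ 2) * (cycProd p (42 * r) (dexp r) * poch p (19 * r) *
        poch p (21 * r + k) * poch p (k - 20 * r - 1) / (poch p k * poch p k *
        poch p (21 * r - k) * poch p (k - r) * ((p : ℝ) ^ j - 1))) ∈ intRange by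
    convert h using 1
    field_simp
  refine mul_mem (pow_div_pow_mem_intRange hp hE) ?_
  have hpoch : ∀ a ≤ 42 * r, poch p a = cycProd p (42 * r) fun l => ((a / l : ℕ) : ℤ) :=
    fun a ha => poch_eq_cycProd hp ha
  rw [hpoch (19 * r) (by omega), hpoch (21 * r + k) (by omega), hpoch k (by omega),
    hpoch (21 * r - k) (by omega), hpoch (k - 20 * r - 1) (by omega), hpoch (k - r) (by omega),
    pow_sub_one_eq_cycProd p (L := 42 * r) hj (by omega)]
  simp only [cycProd_mul hp, cycProd_div hp]
  refine cycProd_mem_intRange fun l hl => ?_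
  have := le_exponent_of_gt hk hk' hl hj hj'
  linarith

/-- A double-pole coefficient is the leading coefficient times an integral combination of `1` and
the numbers `1 / (p ^ i - 1)`, so its denominator is controlled by that of the leading one. -/
lemma scale_mul_coefC_div_mem_of_mem (hp : 2 ≤ p) {r k j : ℕ} (hrk : r ≤ k) (hk : k ≤ 20 * r)
    (hj : 0 < j) (hj' : j ≤ k) :
    scale p r * coefC p (19 * r) (21 * r) r (20 * r) k * (1 / ((p : ℝ) ^ j - 1)) ∈ intRange := by
  set w := scale p r * coefA p (19 * r) (21 * r) r (20 * r) k with hw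
  -- The `u` for which `w * u / (p ^ j - 1)` is an integer form an additive group.
  let G : AddSubgroup ℝ := intRange.toAddSubgroup.comap
    (AddMonoidHom.mulRight (w * (1 / ((p : ℝ) ^ j - 1))))
  have hG : ∀ u, u ∈ G ↔ u * (w * (1 / ((p : ℝ) ^ j - 1))) ∈ intRange := fun u => Iff.rfl
  have hinv : ∀ i, 0 < i → i ≤ 21 * r + k → 1 / ((p : ℝ) ^ i - 1) ∈ G := by
    intro i hi hi'
    rw [hG]
    convert scale_mul_coefA_div_mem hp hrk hk hi hi' hj hj' using 1
    ring
  have hone : (1 : ℝ) ∈ G := by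
    have h1 := hinv 1 one_pos (by omega)
    rw [hG] at h1 ⊢
    have hp1 := one_lt_cast hp
    have h2 : ((p : ℝ) - 1) ∈ intRange := sub_mem (natCast_mem_intRange p) (one_mem _)
    convert mul_mem h2 h1 using 1
    have : (p : ℝ) - 1 ≠ 0 := by linarith
    rw [pow_one]
    field_simp
  have hnat : ∀ m : ℕ, (m : ℝ) ∈ G := fun m => by
    simpa using nsmul_mem hone m
  have hp0 : (p : ℝ) ≠ 0 := (zero_lt_one.trans (one_lt_cast hp)).ne'
  have hquot : ∀ i, 0 < i → i ≤ 21 * r + k → (p : ℝ) ^ i / ((p : ℝ) ^ i - 1) ∈ G := by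
    intro i hi hi'
    have h1 : (p : ℝ) ^ i - 1 ≠ 0 := (sub_pos.2 (one_lt_pow_cast hp hi)).ne'
    convert add_mem hone (hinv i hi hi') using 1
    field_simp
    ring
  have hnode : ∀ i ≤ 21 * r, i ≠ k →
      node p i * (p : ℝ) ^ k / (node p i * (p : ℝ) ^ k - 1) ∈ G := by
    intro i hi hik
    rcases lt_or_gt_of_ne hik with h | h
    · have e : node p i * (p : ℝ) ^ k = (p : ℝ) ^ (k - i) := by
        rw [node, pow_sub₀ _ hp0 h.le, mul_comm]
      rw [e]
      exact hquot _ (by omega) (by omega)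
    · have e : node p i * (p : ℝ) ^ k = ((p : ℝ) ^ (i - k))⁻¹ := by
        rw [node, pow_sub₀ _ hp0 h.le, mul_inv, inv_inv]
      have h1 : (p : ℝ) ^ (i - k) - 1 ≠ 0 :=
        (sub_pos.2 (one_lt_pow_cast hp (by omega))).ne'
      have h2 : (p : ℝ) ^ (i - k) ≠ 0 := pow_ne_zero _ hp0
      have h3 : ((p : ℝ) ^ (i - k))⁻¹ - 1 = -(((p : ℝ) ^ (i - k) - 1) / (p : ℝ) ^ (i - k)) := by
        field_simp
        ring
      rw [e, h3]
      convert neg_mem (hinv (i - k) (by omega) (by omega)) using 1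
      field_simp
  have hlog : logDer p (19 * r) (21 * r) r (20 * r) k ∈ G := by
    rw [logDer]
    refine sub_mem (add_mem (hnat _) (sum_mem fun i hi => ?_))
      (add_mem (sum_mem fun i hi => ?_) (sum_mem fun i hi => ?_))
    · rw [mem_Ioc] at hi
      rw [← pow_add]
      exact hquot _ (by omega) (by omega)
    · rw [mem_erase, mem_range] at hi
      exact hnode i (by omega) hi.1
    · rw [mem_erase, mem_Icc] at hi
      exact hnode i (by omega) hi.1
  have := (hG _).1 (sub_mem hone hlog)
  rw [coefC, if_pos (mem_Icc.2 ⟨hrk, hk⟩)]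
  convert this using 1
  rw [hw]
  ring

lemma scale_mul_sum_coefA_mem (hp : 2 ≤ p) {r : ℕ} (hr : 0 < r) :
    scale p r * ∑ k ∈ Icc r (20 * r), coefA p (19 * r) (21 * r) r (20 * r) k ∈ intRange := by
  rw [mul_sum]
  refine sum_mem fun k hk => ?_
  rw [mem_Icc] at hk
  have h := scale_mul_coefA_div_mem hp hk.1 hk.2 one_pos (by omega) one_pos (by omega)
  have h2 : ((p : ℝ) - 1) ∈ intRange := sub_mem (natCast_mem_intRange p) (one_mem _)
  convert mul_mem (mul_mem h2 h2) h using 1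
  have : (p : ℝ) - 1 ≠ 0 := (sub_pos.2 (one_lt_cast hp)).ne'
  rw [pow_one]
  field_simp

lemma scale_mul_rational_part_mem (hp : 2 ≤ p) (r : ℕ) :
    scale p r * (∑ k ∈ Icc r (20 * r), coefA p (19 * r) (21 * r) r (20 * r) k * harm₂ p k +
      ∑ k ∈ range (21 * r + 1), coefC p (19 * r) (21 * r) r (20 * r) k * harm₁ p k) ∈
      intRange := by
  rw [mul_add, mul_sum, mul_sum]
  refine add_mem (sum_mem fun k hk => ?_) (sum_mem fun k hk => ?_)
  · rw [mem_Icc] at hk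
    rw [harm₂, ← mul_assoc, mul_sum]
    refine sum_mem fun j hj => ?_
    rw [mem_Ioc] at hj
    have h := scale_mul_coefA_div_mem hp hk.1 hk.2 hj.1 (by omega) hj.1 hj.2
    convert mul_mem (pow_mem (natCast_mem_intRange p) j) h using 1
    rw [div_eq_mul_inv, sq, mul_inv, one_div]
    ring
  · rw [mem_range] at hk
    rw [harm₁, ← mul_assoc, mul_sum]
    refine sum_mem fun j hj => ?_
    rw [mem_Ioc] at hj
    by_cases hD : r ≤ k ∧ k ≤ 20 * r
    · exact scale_mul_coefC_div_mem_of_mem hp hD.1 hD.2 hj.1 hj.2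
    · rw [coefC, if_neg (by rwa [mem_Icc])]
      rcases Nat.lt_or_ge k r with h | h
      · exact scale_mul_coefA_div_mem_of_lt hp h hj.1 hj.2
      · exact scale_mul_coefA_div_mem_of_gt hp (by omega) (by omega) hj.1 hj.2

end

section

/-! ### Sizes of the linear forms and of their coefficients -/

variable {p : ℕ}

/-- The logarithm of the common denominator `∏ Φ_l(p) ^ dexp r l`. -/
noncomputable def logDen (p r : ℕ) : ℝ := Real.log (cycProd p (42 * r) (dexp r))

lemma sum_ite_le_log_cyc {a L : ℕ} (h : a ≤ L) :
    ∑ l ∈ Ioc 0 L, (if l ≤ a then Real.log (cyc p l) else 0) = logLcm p a := by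
  rw [← sum_filter, logLcm]
  congr 1
  ext l
  simp only [mem_filter, mem_Ioc]
  omega

lemma logDen_eq (hp : 2 ≤ p) (r : ℕ) :
    logDen p r = logLcm p (20 * r) + logLcm p (21 * r) + logLcm p (10 * r) - logLcm p (11 * r) := by
  rw [logDen, cycProd, Real.log_prod fun l _ => (zpow_pos (cyc_pos hp l) _).ne',
    ← sum_ite_le_log_cyc (L := 42 * r) (a := 20 * r) (by omega),
    ← sum_ite_le_log_cyc (L := 42 * r) (a := 21 * r) (by omega),
    ← sum_ite_le_log_cyc (L := 42 * r) (a := 10 * r) (by omega),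
    ← sum_ite_le_log_cyc (L := 42 * r) (a := 11 * r) (by omega),
    ← sum_add_distrib, ← sum_add_distrib, ← sum_sub_distrib]
  refine sum_congr rfl fun l _ => ?_
  rw [Real.log_zpow, dexp]
  push_cast
  simp only [add_mul, sub_mul, ite_mul, one_mul, zero_mul]

lemma tendsto_logDen (hp : 2 ≤ p) :
    Tendsto (fun r : ℕ => logDen p r / (r : ℝ) ^ 2) atTop
      (𝓝 (2460 / Real.pi ^ 2 * Real.log p)) := by
  have h : ∀ c : ℕ, 0 < c → Tendsto (fun r : ℕ => logLcm p (c * r) / (r : ℝ) ^ 2) atTop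
      (𝓝 ((c : ℝ) ^ 2 * (3 / Real.pi ^ 2 * Real.log p))) := by
    intro c hc
    have h1 : Tendsto (fun r : ℕ => c * r) atTop atTop := tendsto_id.const_mul_atTop' hc
    refine (((tendsto_logLcm hp).comp h1).const_mul ((c : ℝ) ^ 2)).congr fun r => ?_
    have hc' : (c : ℝ) ≠ 0 := by exact_mod_cast hc.ne'
    simp only [Function.comp]
    push_cast
    rw [mul_pow]
    field_simp
  have := (((h 20 (by norm_num)).add (h 21 (by norm_num))).add (h 10 (by norm_num))).sub
    (h 11 (by norm_num))
  refine Tendsto.congr' (Eventually.of_forall fun r => ?_) (this.trans (le_of_eq ?_))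
  · simp only
    rw [logDen_eq hp]
    ring
  · congr 1
    push_cast
    ring

lemma log_two_le (hp : 2 ≤ p) : Real.log 2 ≤ Real.log p :=
  Real.log_le_log two_pos (by exact_mod_cast hp)

lemma tri_cast (a : ℕ) : (tri a : ℝ) = a * (a + 1) / 2 := by
  have := two_mul_tri a
  have h : (2 : ℝ) * tri a = a * (a + 1) := by exact_mod_cast this
  linarith

lemma log_scale (hp : 2 ≤ p) (r : ℕ) :
    Real.log (scale p r) =
      logDen p r + Real.log (poch p (19 * r)) - 299 * (r : ℝ) ^ 2 * Real.log p := by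
  have hp0 : (p : ℝ) ≠ 0 := (zero_lt_one.trans (one_lt_cast hp)).ne'
  have h1 := (cycProd_pos hp (42 * r) (dexp r)).ne'
  have h2 := (poch_pos hp (19 * r)).ne'
  rw [scale, Real.log_div (mul_ne_zero h1 h2) (pow_ne_zero _ hp0), Real.log_mul h1 h2,
    Real.log_pow, logDen]
  push_cast
  ring

lemma le_log_poch' (hp : 2 ≤ p) (a : ℕ) :
    (a * (a + 1) / 2 - a) * Real.log p ≤ Real.log (poch p a) := by
  have h1 := le_log_poch hp a
  have h2 := mul_le_mul_of_nonneg_left (log_two_le hp) (Nat.cast_nonneg (α := ℝ) a)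
  linarith

lemma scale_mul_abs_coefA_le (hp : 2 ≤ p) {r k : ℕ} (hr : 0 < r) (hrk : r ≤ k) (hk : k ≤ 20 * r) :
    scale p r * |coefA p (19 * r) (21 * r) r (20 * r) k| ≤
      Real.exp (logDen p r + (1043 / 2 * (r : ℝ) ^ 2 + 300 * r) * Real.log p) := by
  have hp0 : (0 : ℝ) < p := zero_lt_one.trans (one_lt_cast hp)
  have hL : 0 < Real.log p := Real.log_pos (one_lt_cast hp)
  have hA := abs_coefA_of_mem (M := 19 * r) (N := 21 * r) hp hrk hk (by omega)
  have hP := fun a => poch_pos hp a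
  have hApos : 0 < |coefA p (19 * r) (21 * r) r (20 * r) k| := by
    rw [hA]
    have := hP (21 * r + k)
    have := hP k
    have := hP (21 * r - k)
    have := hP (k - r)
    have := hP (20 * r - k)
    positivity
  rw [← Real.log_le_iff_le_exp (mul_pos (scale_pos hp r) hApos),
    Real.log_mul (scale_pos hp r).ne' hApos.ne', log_scale hp, hA,
    Real.log_mul (pow_pos hp0 _).ne' (by
      have h1 := (hP (21 * r + k)).ne'
      have h2 := (hP k).ne'
      have h3 := (hP (21 * r - k)).ne'
      have h4 := (hP (k - r)).ne'
      have h5 := (hP (20 * r - k)).ne'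
      positivity), Real.log_pow,
    Real.log_div (hP _).ne' (by
      have h2 := (hP k).ne'
      have h3 := (hP (21 * r - k)).ne'
      have h4 := (hP (k - r)).ne'
      have h5 := (hP (20 * r - k)).ne'
      positivity)]
  rw [Real.log_mul (mul_ne_zero (mul_ne_zero (mul_ne_zero (hP _).ne' (hP _).ne') (hP _).ne')
      (hP _).ne') (hP _).ne', Real.log_mul (mul_ne_zero (mul_ne_zero (hP _).ne' (hP _).ne')
      (hP _).ne') (hP _).ne', Real.log_mul (mul_ne_zero (hP _).ne' (hP _).ne') (hP _).ne',
    Real.log_mul (hP _).ne' (hP _).ne']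
  have u1 := log_poch_le hp (19 * r)
  have u2 := log_poch_le hp (21 * r + k)
  have l1 := le_log_poch' hp k
  have l2 := le_log_poch' hp (21 * r - k)
  have l3 := le_log_poch' hp (k - r)
  have l4 := le_log_poch' hp (20 * r - k)
  have hkR : (k : ℝ) ≤ 20 * r := by exact_mod_cast hk
  have hrkR : (r : ℝ) ≤ k := by exact_mod_cast hrk
  push_cast [tri_cast, Nat.cast_sub hrk, Nat.cast_sub hk,
    Nat.cast_sub (show k ≤ 21 * r by omega)] at u1 u2 l1 l2 l3 l4 ⊢
  -- The quadratic part is increasing in `k` up to `k = 20 * r`.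
  have hquad : (41 * r * k - (k : ℝ) ^ 2) ≤ 420 * (r : ℝ) ^ 2 := by nlinarith
  have hlin : 203 / 2 * (r : ℝ) ^ 2 + (41 * r * k - (k : ℝ) ^ 2) + 121 / 2 * r ≤
      1043 / 2 * (r : ℝ) ^ 2 + 300 * r := by linarith [Nat.cast_nonneg (α := ℝ) r]
  have := mul_le_mul_of_nonneg_right hlin hL.le
  linarith

lemma abs_scale_mul_sum_coefA_le (hp : 2 ≤ p) {r : ℕ} (hr : 0 < r) :
    |scale p r * ∑ k ∈ Icc r (20 * r), coefA p (19 * r) (21 * r) r (20 * r) k| ≤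
      Real.exp (logDen p r + (1043 / 2 * (r : ℝ) ^ 2 + 300 * r) * Real.log p + 20 * r) := by
  rw [abs_mul, abs_of_pos (scale_pos hp r)]
  calc _ ≤ scale p r * ∑ k ∈ Icc r (20 * r), |coefA p (19 * r) (21 * r) r (20 * r) k| :=
        mul_le_mul_of_nonneg_left (abs_sum_le_sum_abs _ _) (scale_pos hp r).le
    _ ≤ ∑ _k ∈ Icc r (20 * r),
          Real.exp (logDen p r + (1043 / 2 * (r : ℝ) ^ 2 + 300 * r) * Real.log p) := by
        rw [mul_sum]
        refine sum_le_sum fun k hk => ?_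
        rw [mem_Icc] at hk
        exact scale_mul_abs_coefA_le hp hr hk.1 hk.2
    _ ≤ _ := by
        rw [sum_const, nsmul_eq_mul, Real.exp_add _ (20 * (r : ℝ)), mul_comm]
        gcongr
        rw [Nat.card_Icc]
        have h1 : ((20 * r + 1 - r : ℕ) : ℝ) ≤ 20 * r := by
          exact_mod_cast (by omega : 20 * r + 1 - r ≤ 20 * r)
        have h2 := Real.add_one_le_exp (20 * (r : ℝ))
        linarith

section Value

variable {M N s n : ℕ}

lemma node_le_half (hp : 2 ≤ p) {j : ℕ} (hj : 0 < j) : node p j ≤ 1 / 2 := by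
  rw [node, one_div]
  refine inv_anti₀ two_pos ?_
  calc (2 : ℝ) ≤ p := by exact_mod_cast hp
    _ ≤ (p : ℝ) ^ j := le_self_pow₀ (one_lt_cast hp).le hj.ne'

lemma node_mul_node (p i j : ℕ) : node p i * node p j = node p (i + j) := by
  rw [node, node, node, pow_add, mul_inv]

lemma eval_numer_node_of_le (hp : 2 ≤ p) {t : ℕ} (ht : 0 < t) (htN : t ≤ N) :
    (numer p M N).eval (node p t) = 0 := by
  have hp0 : (p : ℝ) ≠ 0 := (zero_lt_one.trans (one_lt_cast hp)).ne'
  rw [numer, Polynomial.eval_mul, Polynomial.eval_prod,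
    prod_eq_zero (mem_Ioc.2 ⟨ht, htN⟩), mul_zero]
  rw [eval_lin, node, mul_inv_cancel₀ (pow_ne_zero _ hp0), sub_self]

lemma eval_numer_node_bounds (hp : 2 ≤ p) {t : ℕ} (ht : N < t) :
    node p t ^ M * (1 / 2) ^ N ≤ (numer p M N).eval (node p t) ∧
      (numer p M N).eval (node p t) ≤ node p t ^ M := by
  have hp0 : (p : ℝ) ≠ 0 := (zero_lt_one.trans (one_lt_cast hp)).ne'
  have hfac : ∀ j ∈ Ioc 0 N, (p : ℝ) ^ j * node p t = node p (t - j) := fun j hj => by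
    rw [mem_Ioc] at hj
    rw [node, node, pow_sub₀ _ hp0 (by omega), mul_inv, inv_inv, mul_comm]
  have hpow := (pow_pos (node_pos hp t) M).le
  rw [numer, Polynomial.eval_mul, Polynomial.eval_prod, Polynomial.eval_pow, Polynomial.eval_X]
  constructor
  · refine mul_le_mul_of_nonneg_left ?_ hpow
    calc ((1 : ℝ) / 2) ^ N = ∏ _j ∈ Ioc 0 N, (1 / 2 : ℝ) := by simp
      _ ≤ _ := by
        refine prod_le_prod (fun _ _ => by norm_num) fun j hj => ?_
        rw [eval_lin, hfac j hj]
        rw [mem_Ioc] at hj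
        linarith [node_le_half hp (j := t - j) (by omega)]
  · refine mul_le_of_le_one_right hpow (prod_le_one (fun j hj => ?_) fun j hj => ?_)
    · rw [eval_lin, hfac j hj]
      rw [mem_Ioc] at hj
      linarith [node_le_half hp (j := t - j) (by omega)]
    · rw [eval_lin, hfac j hj]
      linarith [node_pos hp (t - j)]

lemma eval_denom_node_bounds (hp : 2 ≤ p) {t : ℕ} (ht : 0 < t) :
    (1 / 2) ^ (N + 1 + (n + 1 - s)) ≤ (denom p N s n).eval (node p t) ∧
      (denom p N s n).eval (node p t) ≤ 1 := by
  have hlow : ∀ S : Finset ℕ, (1 / 2 : ℝ) ^ #S ≤ (∏ i ∈ S, lin (node p i)).eval (node p t) := by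
    intro S
    rw [Polynomial.eval_prod, ← prod_const]
    refine prod_le_prod (fun _ _ => by norm_num) fun i _ => ?_
    rw [eval_lin, node_mul_node]
    linarith [node_le_half hp (j := i + t) (by omega)]
  have hup : ∀ S : Finset ℕ, (∏ i ∈ S, lin (node p i)).eval (node p t) ≤ 1 := by
    intro S
    rw [Polynomial.eval_prod]
    refine prod_le_one (fun i _ => ?_) fun i _ => ?_
    · rw [eval_lin, node_mul_node]
      linarith [node_le_half hp (j := i + t) (by omega)]
    · rw [eval_lin, node_mul_node]
      linarith [node_pos hp (i + t)]
  have hpos : ∀ S : Finset ℕ, 0 ≤ (∏ i ∈ S, lin (node p i)).eval (node p t) := fun S =>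
    (pow_nonneg (by norm_num) _).trans (hlow S)
  rw [denom, den, Polynomial.eval_mul]
  constructor
  · have h1 := hlow (range (N + 1))
    have h2 := hlow (Icc s n)
    rw [card_range] at h1
    rw [Nat.card_Icc] at h2
    rw [pow_add]
    exact mul_le_mul h1 h2 (by positivity) (hpos _)
  · exact mul_le_one₀ (hup _) (hpos _) (hup _)

/-- The linear form is dominated by its first nonvanishing term, at `X = p ^ (-(N + 1))`. -/
lemma value_bounds (hp : 2 ≤ p) (hM : 0 < M) {v : ℝ}
    (hv : HasSum (fun t : ℕ => (numer p M N).eval (node p (t + 1)) /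
      (denom p N s n).eval (node p (t + 1))) v) :
    node p (N + 1) ^ M * (1 / 2) ^ N ≤ v ∧
      v ≤ node p (N + 1) ^ M * 2 ^ (N + 2 + (n + 1 - s)) := by
  have hshift := (hasSum_nat_add_iff' N).2 hv
  rw [sum_eq_zero, sub_zero] at hshift
  swap
  · intro t ht
    rw [mem_range] at ht
    rw [eval_numer_node_of_le hp (by omega) (by omega), zero_div]
  have hden := fun t => eval_denom_node_bounds (N := N) (s := s) (n := n) hp (Nat.succ_pos t)
  have hnum := fun t => eval_numer_node_bounds (M := M) (N := N) hp
    (show N < t + N + 1 by omega)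
  have hhalf : ∀ m : ℕ, (0 : ℝ) < (1 / 2) ^ m := fun m => by positivity
  have hdpos := fun t => (hhalf _).trans_le (hden t).1
  have hnpos : ∀ t, 0 ≤ (numer p M N).eval (node p (t + N + 1)) := fun t =>
    (mul_pos (pow_pos (node_pos hp _) M) (hhalf N)).le.trans (hnum t).1
  constructor
  · refine le_trans ?_ (le_hasSum hshift 0 fun t _ => div_nonneg (hnpos t) (hdpos _).le)
    have h0 := hnum 0
    rw [Nat.zero_add] at h0 ⊢
    rw [le_div_iff₀ (hdpos N)]
    refine le_trans ?_ h0.1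
    exact mul_le_of_le_one_right (mul_pos (pow_pos (node_pos hp _) M) (hhalf N)).le (hden N).2
  · have hq : node p 1 ^ M ≤ 1 / 2 := by
      refine (pow_le_of_le_one (node_pos hp 1).le ?_ hM.ne').trans (node_le_half hp one_pos)
      linarith [node_le_half hp one_pos]
    have hgeo := (hasSum_geometric_of_lt_one (pow_nonneg (node_pos hp 1).le M)
      (by linarith : node p 1 ^ M < 1)).mul_left
        (node p (N + 1) ^ M * 2 ^ (N + 1 + (n + 1 - s)))
    refine (hasSum_le (fun t => ?_) hshift hgeo).trans ?_
    · rw [div_le_iff₀ (hdpos (t + N))]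
      refine (hnum t).2.trans ?_
      have e : node p (t + N + 1) ^ M = node p (N + 1) ^ M * (node p 1 ^ M) ^ t := by
        simp only [node, pow_one, ← pow_mul, inv_pow, ← mul_inv, ← pow_add]
        congr 2
        ring
      have h2 : (1 : ℝ) ≤ 2 ^ (N + 1 + (n + 1 - s)) *
          (denom p N s n).eval (node p (t + N + 1)) := by
        have := mul_le_mul_of_nonneg_left (hden (t + N)).1
          (pow_nonneg zero_le_two (N + 1 + (n + 1 - s)) : (0 : ℝ) ≤ _)
        rwa [← mul_pow, mul_one_div_cancel two_ne_zero, one_pow] at this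
      rw [e]
      have h3 : 0 ≤ node p (N + 1) ^ M * (node p 1 ^ M) ^ t :=
        mul_nonneg (pow_nonneg (node_pos hp _).le _) (pow_nonneg (pow_nonneg (node_pos hp _).le _) _)
      calc _ ≤ node p (N + 1) ^ M * (node p 1 ^ M) ^ t * (2 ^ (N + 1 + (n + 1 - s)) *
            (denom p N s n).eval (node p (t + N + 1))) := le_mul_of_one_le_right h3 h2
        _ = _ := by ring
    · rw [show N + 2 + (n + 1 - s) = N + 1 + (n + 1 - s) + 1 by omega, pow_succ (2 : ℝ),
        ← mul_assoc]
      refine mul_le_mul_of_nonneg_left ?_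
        (mul_nonneg (pow_nonneg (node_pos hp _).le _) (by positivity))
      rw [inv_le_comm₀ (by linarith) two_pos]
      linarith

end Value

lemma scale_mul_value_bounds (hp : 2 ≤ p) {r : ℕ} (hr : 0 < r) {v : ℝ}
    (hv : HasSum (fun t : ℕ => (numer p (19 * r) (21 * r)).eval (node p (t + 1)) /
      (denom p (21 * r) r (20 * r)).eval (node p (t + 1))) v) :
    Real.exp (logDen p r - (1035 / 2 * (r : ℝ) ^ 2 + 100 * r) * Real.log p) ≤ scale p r * v ∧
      scale p r * v ≤
        Real.exp (logDen p r - (1035 / 2 * (r : ℝ) ^ 2 - 100 * r) * Real.log p) := by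
  have hp0 : (0 : ℝ) < p := zero_lt_one.trans (one_lt_cast hp)
  have hL : 0 < Real.log p := Real.log_pos (one_lt_cast hp)
  have hl2 := log_two_le hp
  have hl20 : 0 < Real.log 2 := Real.log_pos (by norm_num)
  obtain ⟨h1, h2⟩ := value_bounds hp (by omega) hv
  have hnode : 0 < node p (21 * r + 1) ^ (19 * r) := pow_pos (node_pos hp _) _
  have hlow : 0 < node p (21 * r + 1) ^ (19 * r) * (1 / 2) ^ (21 * r) := by positivity
  have hvpos : 0 < v := hlow.trans_le h1
  have hr1 : (1 : ℝ) ≤ r := by exact_mod_cast hr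
  have hlogn : Real.log (node p (21 * r + 1) ^ (19 * r)) =
      -((21 * r + 1) * (19 * r)) * Real.log p := by
    rw [Real.log_pow, node, Real.log_inv, Real.log_pow]
    push_cast
    ring
  have u := log_poch_le hp (19 * r)
  have l := le_log_poch' hp (19 * r)
  push_cast at u l
  have hrL : 0 ≤ r * Real.log p := by positivity
  constructor
  · rw [← Real.le_log_iff_exp_le (mul_pos (scale_pos hp r) hvpos),
      Real.log_mul (scale_pos hp r).ne' hvpos.ne', log_scale hp]
    have h3 := Real.log_le_log hlow h1
    rw [Real.log_mul hnode.ne' (by positivity), hlogn, Real.log_pow, one_div, Real.log_inv] at h3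
    push_cast at h3
    have h4 := mul_le_mul_of_nonneg_left hl2 (by positivity : (0 : ℝ) ≤ r)
    linarith
  · rw [← Real.log_le_iff_le_exp (mul_pos (scale_pos hp r) hvpos),
      Real.log_mul (scale_pos hp r).ne' hvpos.ne', log_scale hp]
    have h3 := Real.log_le_log hvpos h2
    rw [Real.log_mul hnode.ne' (by positivity), hlogn, Real.log_pow,
      show 21 * r + 2 + (20 * r + 1 - r) = 40 * r + 3 by omega] at h3
    push_cast at h3
    have h4 := mul_le_mul_of_nonneg_left hl2 (by positivity : (0 : ℝ) ≤ 40 * r + 3)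
    have h5 := mul_le_mul_of_nonneg_right hr1 hL.le
    linarith

end

section

/-! ### From linear forms to approximation exponents -/

/-- Lower bounds for `|x - a / b|` from small linear forms `B r * x - A r` of quadratic-exponential
size. The two-sided bound on the forms replaces a determinant condition: it covers the case
in which `a / b` is one of the fractions `A r / B r`. -/
lemma exists_forall_lt_abs_sub {x a₁ a₂ b₁ η : ℝ} {A B : ℕ → ℤ} (ha : a₁ ≤ a₂) (hη : 0 < η)
    (hab : 0 ≤ a₂ + b₁) (h : a₂ + b₁ < η * a₁)
    (hlow : ∀ᶠ r : ℕ in atTop, Real.exp (-a₂ * (r : ℝ) ^ 2) ≤ B r * x - A r)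
    (hup : ∀ᶠ r : ℕ in atTop, B r * x - A r ≤ Real.exp (-a₁ * (r : ℝ) ^ 2))
    (hB : ∀ᶠ r : ℕ in atTop, |(B r : ℝ)| ≤ Real.exp (b₁ * (r : ℝ) ^ 2)) :
    ∀ᶠ b : ℤ in atTop, ∀ a : ℤ, (b : ℝ) ^ (-η) < |x - (a : ℝ) / b| := by
  have ha₁ : 0 < a₁ := pos_of_mul_pos_right (hab.trans_lt h) hη.le
  obtain ⟨r₀, hr₀⟩ := eventually_atTop.1 (hlow.and (hup.and hB))
  have hy : Tendsto (fun b : ℤ => Real.sqrt (Real.log (2 * (b : ℝ)) / a₁)) atTop atTop :=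
    Real.tendsto_sqrt_atTop.comp ((Real.tendsto_log_atTop.comp
      ((tendsto_intCast_atTop_atTop (R := ℝ)).const_mul_atTop two_pos)).atTop_div_const ha₁)
  set c := a₂ + b₁ with hc
  set d := η * a₁ - c with hd
  have hdpos : 0 < d := sub_pos.2 h
  have hl2 : 0 < Real.log 2 := Real.log_pos (by norm_num)
  filter_upwards [eventually_ge_atTop (1 : ℤ), hy.eventually_ge_atTop (r₀ : ℝ),
    hy.eventually_ge_atTop ((3 * c + η * Real.log 2) / d + 1)] with b hb hyr hyd a
  have hb0 : (1 : ℝ) ≤ b := by exact_mod_cast hb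
  set y := Real.sqrt (Real.log (2 * (b : ℝ)) / a₁) with hydef
  have hlog : 0 ≤ Real.log (2 * (b : ℝ)) := Real.log_nonneg (by linarith)
  have hy2 : a₁ * y ^ 2 = Real.log (2 * (b : ℝ)) := by
    rw [hydef, Real.sq_sqrt (div_nonneg hlog ha₁.le)]
    field_simp
  have hy1 : 1 ≤ y := le_trans (le_add_of_nonneg_left (by positivity)) hyd
  -- The least `r` whose form is at most `1 / (2 * b)`, up to rounding.
  set r := ⌈y⌉₊ with hr
  have hyr' : y ≤ r := Nat.le_ceil y
  have hry : (r : ℝ) < y + 1 := Nat.ceil_lt_add_one (by linarith)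
  have hrr : r₀ ≤ r := by exact_mod_cast hyr.trans hyr'
  obtain ⟨h1, h2, h3⟩ := hr₀ r hrr
  have hsq : y ^ 2 ≤ (r : ℝ) ^ 2 := by gcongr
  have hhalf : Real.exp (-a₁ * (r : ℝ) ^ 2) ≤ 1 / (2 * b) := by
    rw [one_div, ← Real.exp_log (show (0 : ℝ) < 2 * b by linarith), ← Real.exp_neg,
      Real.exp_le_exp]
    nlinarith
  have hle : Real.exp (-a₂ * (r : ℝ) ^ 2) ≤ Real.exp (-a₁ * (r : ℝ) ^ 2) := by
    rw [Real.exp_le_exp]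
    nlinarith [sq_nonneg (r : ℝ)]
  have hb' : (b : ℝ) ≠ 0 := by linarith
  have hmain : Real.exp (-a₂ * (r : ℝ) ^ 2) ≤ |(B r : ℝ)| * |x - (a : ℝ) / b| := by
    rw [← abs_mul]
    by_cases heq : B r * a = A r * b
    · have heq' : (B r : ℝ) * a = A r * b := by exact_mod_cast heq
      have : (B r : ℝ) * (x - (a : ℝ) / b) = B r * x - A r := by
        field_simp
        linarith
      rw [this]
      exact h1.trans (le_abs_self _)
    · have hint : (1 : ℝ) ≤ |(B r : ℝ) * a - A r * b| := by
        exact_mod_cast Int.one_le_abs (sub_ne_zero.2 heq)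
      have e : (B r : ℝ) * (x - (a : ℝ) / b) =
          (B r * x - A r) - (B r * a - A r * b) / b := by
        field_simp
        ring
      have hdiv : 1 / (b : ℝ) ≤ |((B r : ℝ) * a - A r * b) / b| := by
        rw [abs_div, abs_of_pos (show (0 : ℝ) < b by linarith)]
        gcongr
      have htri := abs_sub_abs_le_abs_sub (((B r : ℝ) * a - A r * b) / b) (B r * x - A r)
      have hpos : 0 < (B r : ℝ) * x - A r := (Real.exp_pos _).trans_le h1
      rw [abs_of_pos hpos, abs_sub_comm] at htri
      have hsplit : 1 / (b : ℝ) = 1 / (2 * b) + 1 / (2 * b) := by field_simp; norm_num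
      rw [e]
      linarith
  have hfin : Real.exp (-c * (r : ℝ) ^ 2) ≤ |x - (a : ℝ) / b| := by
    have h4 : Real.exp (-a₂ * (r : ℝ) ^ 2) ≤
        Real.exp (b₁ * (r : ℝ) ^ 2) * |x - (a : ℝ) / b| :=
      hmain.trans (mul_le_mul_of_nonneg_right h3 (abs_nonneg _))
    have e : Real.exp (-c * (r : ℝ) ^ 2) =
        (Real.exp (b₁ * (r : ℝ) ^ 2))⁻¹ * Real.exp (-a₂ * (r : ℝ) ^ 2) := by
      rw [← Real.exp_neg, ← Real.exp_add, hc]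
      congr 1
      ring
    rw [e, inv_mul_le_iff₀ (Real.exp_pos _)]
    exact h4
  refine lt_of_lt_of_le ?_ hfin
  rw [Real.rpow_def_of_pos (by linarith), Real.exp_lt_exp]
  have hlogb : Real.log b = a₁ * y ^ 2 - Real.log 2 := by
    rw [hy2, Real.log_mul two_ne_zero hb']
    ring
  have hr2 : c * (r : ℝ) ^ 2 ≤ c * (y + 1) ^ 2 := by gcongr
  have hdy : 3 * c + η * Real.log 2 + d ≤ d * y := by
    have := mul_le_mul_of_nonneg_left hyd hdpos.le
    rw [mul_add, mul_div_cancel₀ _ hdpos.ne'] at this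
    linarith
  have hdy2 : (3 * c + η * Real.log 2 + d) * y ≤ d * y ^ 2 := by nlinarith
  have hηl : 0 ≤ η * Real.log 2 := by positivity
  rw [hlogb]
  have e1 : (a₁ * y ^ 2 - Real.log 2) * -η = -(d + c) * y ^ 2 + η * Real.log 2 := by
    rw [hd]; ring
  rw [e1]
  nlinarith

/-- An exponent of approximation valid for large positive denominators gives irrationality,
finiteness of the set of very good approximations, and a bound for the irrationality measure. -/
lemma irrational_and_finite_and_measure_le {x η ρ : ℝ} (hηρ : η < ρ) (hη : 0 < η)
    (h : ∀ᶠ b : ℤ in atTop, ∀ a : ℤ, (b : ℝ) ^ (-η) < |x - (a : ℝ) / b|) :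
    Irrational x ∧
    {ab : ℤ × ℤ | ab.2 ≠ 0 ∧ |x - (ab.1 : ℝ) / (ab.2 : ℝ)| ≤ |(ab.2 : ℝ)| ^ (-ρ)}.Finite ∧
    irrationalityMeasure x ≤ (ρ : EReal) := by
  obtain ⟨b₀, hb₀⟩ := eventually_atTop.1 (h.and (eventually_ge_atTop 1))
  have h1 : ∀ b ≥ b₀, (1 : ℝ) ≤ b := fun b hb => by exact_mod_cast (hb₀ b hb).2
  refine ⟨?_, ?_, ?_⟩
  · rintro ⟨u, rfl⟩
    have hden : (u.den : ℝ) ≠ 0 := by exact_mod_cast u.den_nz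
    have hdpos : (1 : ℤ) ≤ u.den := by exact_mod_cast u.den_pos
    have hc : b₀ ≤ u.den * max b₀ 1 := by
      nlinarith [le_max_left b₀ 1, le_max_right b₀ 1]
    have hm : ((max b₀ 1 : ℤ) : ℝ) ≠ 0 := by
      have := le_max_right b₀ 1
      exact_mod_cast (by omega : max b₀ 1 ≠ 0)
    have := (hb₀ _ hc).1 (u.num * max b₀ 1)
    have e : (u : ℝ) - ((u.num * max b₀ 1 : ℤ) : ℝ) / ((u.den * max b₀ 1 : ℤ) : ℝ) = 0 := by
      push_cast [Rat.cast_def]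
      push_cast at hm
      rw [mul_div_mul_right _ _ hm, sub_self]
    rw [e, abs_zero] at this
    exact absurd this (not_lt.2 (Real.rpow_nonneg (by linarith [h1 _ hc]) _))
  · -- Both the denominators and, for each denominator, the numerators are bounded.
    set C : ℤ := max b₀ 1 with hC
    have hbd : ∀ a b : ℤ, b ≥ b₀ → ¬|x - (a : ℝ) / b| ≤ |(b : ℝ)| ^ (-ρ) := by
      intro a b hb hle
      have hb1 := h1 b hb
      rw [abs_of_pos (by linarith : (0 : ℝ) < b)] at hle
      have := (hb₀ b hb).1 a
      have h3 : (b : ℝ) ^ (-ρ) ≤ (b : ℝ) ^ (-η) := Real.rpow_le_rpow_of_exponent_le hb1 (by linarith)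
      linarith
    have hρ : 0 < ρ := hη.trans hηρ
    refine Set.Finite.subset ((Set.finite_Icc (-⌈(C : ℝ) * (|x| + 1)⌉) ⌈(C : ℝ) * (|x| + 1)⌉).prod
      (Set.finite_Icc (-C) C)) ?_
    rintro ⟨a, b⟩ ⟨hb, hle⟩
    simp only at hb hle
    have hbC : |b| ≤ C := by
      by_contra hlt
      rw [not_le] at hlt
      have hC0 : b₀ ≤ C := le_max_left _ _
      rcases abs_choice b with e | e
      · exact hbd a b (by omega) hle
      · refine hbd (-a) (-b) (by omega) ?_
        push_cast
        rwa [neg_div_neg_eq, abs_neg]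
    have hb1 : (1 : ℝ) ≤ |(b : ℝ)| := by exact_mod_cast Int.one_le_abs hb
    have hb0 : (b : ℝ) ≠ 0 := by exact_mod_cast hb
    have hle1 : |x - (a : ℝ) / b| ≤ 1 :=
      hle.trans (Real.rpow_le_one_of_one_le_of_nonpos hb1 (by linarith))
    have hbC' : |(b : ℝ)| ≤ C := by exact_mod_cast hbC
    have hfrac : |(a : ℝ) / b| ≤ |x| + 1 := by
      have := abs_sub_abs_le_abs_sub ((a : ℝ) / b) x
      rw [abs_sub_comm] at this
      linarith
    have haC : |(a : ℝ)| ≤ C * (|x| + 1) := by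
      have e : (a : ℝ) = b * (a / b) := by field_simp
      rw [e, abs_mul]
      exact mul_le_mul hbC' hfrac (abs_nonneg _) (by linarith)
    have haC' : |a| ≤ ⌈(C : ℝ) * (|x| + 1)⌉ := by
      have := haC.trans (Int.le_ceil _)
      exact_mod_cast this
    exact ⟨abs_le.1 haC', abs_le.1 hbC⟩
  · refine sInf_le ⟨ρ, rfl, fun ε hε => ?_⟩
    filter_upwards [eventually_ge_atTop b₀] with b hb a _
    refine lt_of_le_of_lt ?_ ((hb₀ b hb).1 a)
    have hb1 := h1 b hb
    rw [one_div, ← Real.rpow_neg (by linarith)]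
    exact Real.rpow_le_rpow_of_exponent_le hb1 (by linarith)

end

section

/-! ### The approximation exponent of `ζ_q(2)` -/

/-- The integer linear forms in `1` and `ζ_q(2)` with their sizes. -/
lemma exists_linearForm {p : ℕ} (hp : 2 ≤ p) {r : ℕ} (hr : 0 < r) :
    ∃ B A : ℤ,
      Real.exp (logDen p r - (1035 / 2 * (r : ℝ) ^ 2 + 100 * r) * Real.log p) ≤
        B * qZeta (1 / (p : ℝ)) 2 - A ∧
      B * qZeta (1 / (p : ℝ)) 2 - A ≤
        Real.exp (logDen p r - (1035 / 2 * (r : ℝ) ^ 2 - 100 * r) * Real.log p) ∧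
      |(B : ℝ)| ≤
        Real.exp (logDen p r + (1043 / 2 * (r : ℝ) ^ 2 + 300 * r) * Real.log p + 20 * r) := by
  obtain ⟨B, hB⟩ := scale_mul_sum_coefA_mem hp hr
  obtain ⟨A, hA⟩ := scale_mul_rational_part_mem hp r
  rw [Int.coe_castRingHom] at hA hB
  dsimp only at hA hB
  have hv := hasSum_linearForm (M := 19 * r) (N := 21 * r) (s := r) (n := 20 * r) hp
    (by omega) (by omega) (by omega) (by omega)
  have hbd := scale_mul_value_bounds hp hr hv
  have e : scale p r * (∑ k ∈ Icc r (20 * r), coefA p (19 * r) (21 * r) r (20 * r) k *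
        (qZeta (1 / (p : ℝ)) 2 - harm₂ p k) -
      ∑ k ∈ range (21 * r + 1), coefC p (19 * r) (21 * r) r (20 * r) k * harm₁ p k) =
      B * qZeta (1 / (p : ℝ)) 2 - A := by
    rw [hA, hB]
    simp_rw [mul_sub]
    rw [sum_sub_distrib, ← sum_mul]
    ring
  rw [e] at hbd
  refine ⟨B, A, hbd.1, hbd.2, ?_⟩
  rw [hB]
  exact abs_scale_mul_sum_coefA_le hp hr

/-- The exponent reached by the linear forms is strictly smaller than
`10 π² / (5 π² - 24)`, the exponent that the choice `s = 0`, `M = N = n` would give. -/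
lemma exponent_lt {L : ℝ} (hL : 0 < L) :
    0 < (1035 / 2 - 2460 / Real.pi ^ 2) * L ∧
    (1035 / 2 - 2460 / Real.pi ^ 2) * L + (1043 / 2 + 2460 / Real.pi ^ 2) * L <
      10 * Real.pi ^ 2 / (5 * Real.pi ^ 2 - 24) * ((1035 / 2 - 2460 / Real.pi ^ 2) * L) := by
  have h1 := Real.pi_gt_three
  have h2 := Real.pi_lt_four
  have h3 : (9 : ℝ) < Real.pi ^ 2 := by nlinarith
  have h4 : Real.pi ^ 2 < (16 : ℝ) := by nlinarith
  have h5 : (1035 / 2 - 2460 / Real.pi ^ 2) = (1035 * Real.pi ^ 2 - 4920) / (2 * Real.pi ^ 2) := by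
    field_simp
    ring
  have h6 : 0 < 5 * Real.pi ^ 2 - 24 := by linarith
  refine ⟨mul_pos ?_ hL, ?_⟩
  · rw [h5]
    exact div_pos (by linarith) (by positivity)
  · have e : 10 * Real.pi ^ 2 / (5 * Real.pi ^ 2 - 24) * ((1035 / 2 - 2460 / Real.pi ^ 2) * L) =
        (5 * (1035 * Real.pi ^ 2 - 4920) / (5 * Real.pi ^ 2 - 24)) * L := by
      rw [h5]
      field_simp
      ring
    rw [e, ← add_mul]
    refine mul_lt_mul_of_pos_right ?_ hL
    rw [lt_div_iff₀ h6]
    have : 1035 / 2 - 2460 / Real.pi ^ 2 + (1043 / 2 + 2460 / Real.pi ^ 2) = 1039 := by ring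
    rw [this]
    linarith

end

end QZetaTwo

open QZetaTwo Filter in
theorem theorem1 (p : ℕ) (hp : 2 ≤ p) (q : ℝ) (hq : q = 1 / (p : ℝ)) (ρ : ℝ)
    (hρ : ρ = 10 * Real.pi ^ 2 / (5 * Real.pi ^ 2 - 24)) :
    Irrational (qZeta q 2) ∧
    {ab : ℤ × ℤ | ab.2 ≠ 0 ∧
      |qZeta q 2 - (ab.1 : ℝ) / (ab.2 : ℝ)| ≤ |(ab.2 : ℝ)| ^ (-ρ)}.Finite ∧
    irrationalityMeasure (qZeta q 2) ≤ (ρ : EReal) := by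
  have hL : 0 < Real.log p := Real.log_pos (one_lt_cast hp)
  obtain ⟨hα, hlt⟩ := exponent_lt hL
  rw [← hρ] at hlt
  set g := 2460 / Real.pi ^ 2 * Real.log p with hg
  set α := (1035 / 2 - 2460 / Real.pi ^ 2) * Real.log p with hαdef
  set β := (1043 / 2 + 2460 / Real.pi ^ 2) * Real.log p with hβdef
  have hβ : 0 < β := by positivity
  -- Slack in the exponent, to absorb all errors of size `o(r ^ 2)`.
  obtain ⟨η, hη, hηρ⟩ := exists_between ((div_lt_iff₀ hα).2 hlt)
  rw [div_lt_iff₀ hα] at hη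
  have hηpos : 0 < η := pos_of_mul_pos_left ((add_pos hα hβ).trans hη) hα.le
  set δ := (η * α - (α + β)) / (2 * (η + 2)) with hδ
  have hδpos : 0 < δ := div_pos (sub_pos.2 hη) (by positivity)
  have hδeq : 2 * (η + 2) * δ = η * α - (α + β) := by
    rw [hδ]
    field_simp
  choose B A hBA using fun r : ℕ => fun hr : 0 < r => exists_linearForm hp hr
  have hden : ∀ᶠ r : ℕ in atTop, |logDen p r - g * (r : ℝ) ^ 2| ≤ δ / 2 * (r : ℝ) ^ 2 := by
    filter_upwards [(Metric.tendsto_nhds.1 (tendsto_logDen hp)) (δ / 2) (by positivity),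
      eventually_gt_atTop 0] with r h hr
    have hr' : (0 : ℝ) < (r : ℝ) ^ 2 := by positivity
    rw [Real.dist_eq, ← hg] at h
    have e : logDen p r - g * (r : ℝ) ^ 2 = (logDen p r / (r : ℝ) ^ 2 - g) * (r : ℝ) ^ 2 := by
      field_simp
    rw [e, abs_mul, abs_of_pos hr']
    exact mul_le_mul_of_nonneg_right h.le hr'.le
  have hlin : ∀ᶠ r : ℕ in atTop, 300 * r * Real.log p + 20 * r ≤ δ / 2 * (r : ℝ) ^ 2 := by
    filter_upwards [(tendsto_natCast_atTop_atTop (R := ℝ)).eventually_ge_atTop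
      ((300 * Real.log p + 20) / (δ / 2))] with r h
    rw [div_le_iff₀ (by positivity)] at h
    have := mul_le_mul_of_nonneg_left h (Nat.cast_nonneg (α := ℝ) r)
    linarith
  subst hq
  refine irrational_and_finite_and_measure_le hηρ hηpos (exists_forall_lt_abs_sub
    (a₁ := α - δ) (a₂ := α + δ) (b₁ := β + δ)
    (A := fun r => if h : 0 < r then A r h else 0) (B := fun r => if h : 0 < r then B r h else 0)
    (by linarith) hηpos (by linarith) (by linarith) ?_ ?_ ?_)
  · filter_upwards [hden, hlin, eventually_gt_atTop 0] with r h1 h2 hr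
    rw [dif_pos hr, dif_pos hr]
    refine le_trans (Real.exp_le_exp.2 ?_) (hBA r hr).1
    have h3 := (abs_le.1 h1).1
    have h4 : 0 ≤ (r : ℝ) * Real.log p := by positivity
    have h5 : (0 : ℝ) ≤ r := Nat.cast_nonneg r
    rw [hαdef]
    linarith
  · filter_upwards [hden, hlin, eventually_gt_atTop 0] with r h1 h2 hr
    rw [dif_pos hr, dif_pos hr]
    refine le_trans (hBA r hr).2.1 (Real.exp_le_exp.2 ?_)
    have h3 := (abs_le.1 h1).2
    have h4 : 0 ≤ (r : ℝ) * Real.log p := by positivity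
    have h5 : (0 : ℝ) ≤ r := Nat.cast_nonneg r
    rw [hαdef]
    linarith
  · filter_upwards [hden, hlin, eventually_gt_atTop 0] with r h1 h2 hr
    rw [dif_pos hr]
    refine le_trans (hBA r hr).2.2 (Real.exp_le_exp.2 ?_)
    have h3 := (abs_le.1 h1).2
    rw [hβdef]
    linarith
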